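/- Let $D\ge 1$, let $\Lambda$ be an index set, and for every $\lambda\in\Lambda$ let an affine iterated function system $F^\lambda=\{f^\lambda_1,\dots,f^\lambda_{M_\lambda}\}$ on $\mathbb R^D$ be given, $f^\lambda_i(x)=T^\lambda_i x+a^\lambda_i$, where $M_\lambda\ge 1$ and $\sup_\lambda M_\lambda<\infty$. Let $\sim$ be an equivalence relation on $\{(\lambda,i): 1\le i\le M_\lambda\}$ with a finite number $\mathcal A$ of classes such that $(\lambda,i)\sim(\lambda,j)$ only if $i=j$. Maps in the same class share their translation vector, so that the translations are given by one parameter ${\bf a}\in(\mathbb R^D)^{\mathcal A}=\mathbb R^{D\mathcal A}$. A code tree $\omega$ is a labelling, by elements of $\Lambda$, of a set $\Sigma^\omega_*$ of finite words such that $\emptyset\in\Sigma^\omega_*$ and $\tau l\in\Sigma^\omega_*$ if and only if $\tau\in\Sigma^\omega_*$ and $1\le l\le M_{\omega(\tau)}$. For an infinite word ${\bf i}=i_1i_2\cdots$ all of whose initial words lie in $\Sigma_*^\omega$ set $Z^\omega_{\bf a}({\bf i})=\lim_{k\to\infty} f^{\omega(\emptyset)}_{i_1}\circ f^{\omega(i_1)}_{i_2}\circ\dots\circ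 f^{\omega(i_1\cdots i_{k-1})}_{i_k}(0)$, and let $A^\omega_{\bf a}$ be the set of all these points. For $\tau=i_1\cdots i_k\in\Sigma_*^\omega$ write $T^\omega_\tau=T^{\omega(\emptyset)}_{i_1}\cdots T^{\omega(i_1\cdots i_{k-1})}_{i_k}$. The pressure of $\omega$ at $\alpha\ge 0$ is $p^\omega(\alpha)=\lim_{k\to\infty}\frac1k\log\sum_{\tau\in\Sigma^\omega_*,\,|\tau|=k}\Phi^\alpha(T^\omega_\tau)$ if the limit exists, where $\Phi^\alpha$ is the singular value function: if $\sigma_1(T)\ge\dots\ge\sigma_D(T)$ are the singular values of $T$, then $\Phi^\alpha(T)=\sigma_1\cdots\sigma_{m-1}\sigma_m^{\alpha-m+1}$ if $m-1\le\alpha<m\le D$ with $m$ an integer, and $\Phi^\alpha(T)=\sigma_1\cdots\sigma_{D-1}\sigma_D^{\alpha-D+1}$ if $\alpha\ge D$. Let $\widetilde\Omega$ be the set of all pairs $\tilde\omega=(\omega,N)$ of a code tree $\omega$ and a sequence of integers $1\le N_1<N_2<\cdots$ (neck levels) such that, for every $m$, all sub code trees of $\omega$ rooted at level $N_m$ are identical.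 Let $\Xi(\omega,N)=(\hat\omega,\hat N)$, where $\hat N_m=N_{m+1}-N_1$ and $\hat\omega$ is the sub code tree of $\omega$ rooted at level $N_1$. Equip $\widetilde\Omega$ with the topology generated by the cylinders $\{(\hat\omega,\hat N): \hat N_i=N_i \text{ for } i\le m,\ \hat\omega=\omega \text{ on words of length}<N_m\}$, for $(\omega,N)\in\widetilde\Omega$ and $m\ge1$, and with its Borel $\sigma$-algebra. For $\tilde\omega=(\omega,N)$ write $p^{\tilde\omega}=p^\omega$ and $A^{\tilde\omega}_{\bf a}=A^\omega_{\bf a}$. Proposition 5.7. Assume that all the maps $f^\lambda_i$ are similarities and that there are constants $\underline\sigma,\overline\sigma$ with $0<\underline\sigma\le\sigma_D(T^\lambda_i)\le\sigma_1(T^\lambda_i)\le\overline\sigma<\frac12$ for all $\lambda$ and $i$. Let $P$ be an ergodic $\Xi$-invariant Borel probability measure on $\widetilde\Omega$ with $\int_{\widetilde\Omega} N_1\,dP<\infty$. Then there is a function $p\colon[0,\infty)\to\mathbb R$ with a unique zero $\alpha_0\in[0,\infty)$ such that for $P$-almost all $\tilde\omega$ the pressure $p^{\tilde\omega}(\alpha)$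 exists and equals $p(\alpha)$ for all $\alpha\ge 0$, and for $P$-almost all $\tilde\omega\in\widetilde\Omega$ $$\dim_H(A^{\tilde\omega}_{\bf a})=\min\{\alpha_0,D\}\quad\text{for Lebesgue-almost all }{\bf a}\in\mathbb R^{D\mathcal A}.$$ -/

import Mathlib

open MeasureTheory Filter Topology

noncomputable section

namespace CodeTreeFractal

/-- The singular value function `Φ^α(T)` of a linear map on `ℝ^D` (`D ≥ 1`, `α ≥ 0`).
Mathlib's singular values are decreasing and indexed from `0`, so `σ_j` is
`T.singularValues (j - 1)`. For `0 ≤ α < D` and `m - 1 ≤ α < m` the value is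
`σ_1 ⋯ σ_{m-1} σ_m ^ (α - m + 1)`, and for `α ≥ D` it is `σ_1 ⋯ σ_{D-1} σ_D ^ (α - D + 1)`. -/
def svf {D : ℕ} (α : ℝ) (T : EuclideanSpace ℝ (Fin D) →ₗ[ℝ] EuclideanSpace ℝ (Fin D)) : ℝ :=
  if α < D then
    (∏ j ∈ Finset.range ⌊α⌋₊, T.singularValues j) *
      T.singularValues ⌊α⌋₊ ^ (α - (⌊α⌋₊ : ℝ))
  else
    (∏ j ∈ Finset.range (D - 1), T.singularValues j) *
      T.singularValues (D - 1) ^ (α - (D : ℝ) + 1)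

/-- Similarities: maps that multiply all distances by one positive constant. -/
def IsSimilarity {X : Type*} [PseudoMetricSpace X] (f : X → X) : Prop :=
  ∃ r : ℝ, 0 < r ∧ ∀ x y, dist (f x) (f y) = r * dist x y

/-- The data of a family of affine iterated function systems on `ℝ^D`, indexed by `Λ`:
the `lam`-th system has `m lam ≥ 1` maps, with linear parts `T lam i`, and `m` is bounded.
The equivalence relation `rel` on the pairs `(lam, i)` tells which translation vectors are
identified; two different maps of the same system never share their translation vector.
The letters are `0, …, m lam - 1`. -/
structure AffineFamily (D : ℕ) (Λ : Type*) where
  m : Λ → ℕ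
  m_pos : ∀ lam, 0 < m lam
  m_bdd : BddAbove (Set.range m)
  T : (lam : Λ) → Fin (m lam) → EuclideanSpace ℝ (Fin D) →ₗ[ℝ] EuclideanSpace ℝ (Fin D)
  rel : Setoid (Σ lam : Λ, Fin (m lam))
  rel_inj : ∀ (lam : Λ) (i j : Fin (m lam)), rel ⟨lam, i⟩ ⟨lam, j⟩ → i = j

namespace AffineFamily

variable {D : ℕ} {Λ : Type*} (F : AffineFamily D Λ)

/-- The translation parameters: one vector of `ℝ^D` for each equivalence class. -/
abbrev Param : Type _ := Quotient F.rel → EuclideanSpace ℝ (Fin D)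

/-- The linear part of the map with letter `i` in the system with label `o`
(the value `0` is only taken if there is no such map). -/
def lin (o : Option Λ) (i : ℕ) : EuclideanSpace ℝ (Fin D) →ₗ[ℝ] EuclideanSpace ℝ (Fin D) :=
  match o with
  | some lam => if h : i < F.m lam then F.T lam ⟨i, h⟩ else 0
  | none => 0

/-- The translation part of the map with letter `i` in the system with label `o`
(the value `0` is only taken if there is no such map). -/
def trans (a : F.Param) (o : Option Λ) (i : ℕ) : EuclideanSpace ℝ (Fin D) :=
  match o with
  | some lam => if h : i < F.m lam then a (Quotient.mk F.rel ⟨lam, ⟨i, h⟩⟩) else 0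
  | none => 0

/-- `T_{i_1}^{g(∅)} T_{i_2}^{g(i_1)} ⋯ T_{i_k}^{g(i_1 ⋯ i_{k-1})}` for the word
`[i_1, …, i_k]` and the labelling `g` of words. -/
def linWord : (List ℕ → Option Λ) → List ℕ →
    EuclideanSpace ℝ (Fin D) →ₗ[ℝ] EuclideanSpace ℝ (Fin D)
  | _, [] => LinearMap.id
  | g, i :: w => F.lin (g []) i ∘ₗ linWord (fun τ => g (i :: τ)) w

/-- `f_{i_1}^{g(∅)} ∘ f_{i_2}^{g(i_1)} ∘ ⋯ ∘ f_{i_k}^{g(i_1 ⋯ i_{k-1})}` for the word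
`[i_1, …, i_k]` and the labelling `g` of words, with translation parameters `a`. -/
def mapWord (a : F.Param) : (List ℕ → Option Λ) → List ℕ →
    EuclideanSpace ℝ (Fin D) → EuclideanSpace ℝ (Fin D)
  | _, [], x => x
  | g, i :: w, x => F.lin (g []) i (mapWord a (fun τ => g (i :: τ)) w x) + F.trans a (g []) i

end AffineFamily

/-- A code tree: a labelling by elements of `Λ` of a set of finite words, which contains the
empty word and which contains `τl` if and only if it contains `τ`, with label `lam` say, and
`l` is a letter of the system `lam`. The label of a word outside this set is `none`. -/
@[ext]
structure CodeTree {D : ℕ} {Λ : Type*} (F : AffineFamily D Λ) where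
  label : List ℕ → Option Λ
  root : (label []).isSome
  child : ∀ (τ : List ℕ) (l : ℕ),
    (label (τ ++ [l])).isSome ↔ ∃ lam, label τ = some lam ∧ l < F.m lam

namespace CodeTree

variable {D : ℕ} {Λ : Type*} {F : AffineFamily D Λ} (ω : CodeTree F)

/-- The set `Σ_*^ω` of finite words of the code tree. -/
def words : Set (List ℕ) := {τ | (ω.label τ).isSome}

theorem finite_words (k : ℕ) : {τ | τ ∈ ω.words ∧ τ.length = k}.Finite := by
  obtain ⟨M, hM⟩ := F.m_bdd
  induction k with
  | zero =>
    refine (Set.finite_singleton []).subset ?_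
    rintro τ ⟨-, h⟩
    simpa using h
  | succ k ih =>
    refine ((ih.prod (Set.finite_lt_nat M)).image (fun p => p.1 ++ [p.2])).subset ?_
    rintro τ ⟨h, hl⟩
    rcases List.eq_nil_or_concat' τ with rfl | ⟨σ, l, rfl⟩
    · simp at hl
    · obtain ⟨lam, h1, h2⟩ := (ω.child σ l).1 h
      refine ⟨(σ, l), ⟨⟨?_, by simpa using hl⟩, ?_⟩, rfl⟩
      · simp [words, h1]
      · exact lt_of_lt_of_le h2 (hM ⟨lam, rfl⟩)

theorem replicate_mem (k : ℕ) : List.replicate k 0 ∈ ω.words := by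
  induction k with
  | zero => exact ω.root
  | succ k ih =>
    rw [List.replicate_succ']
    obtain ⟨lam, h⟩ := Option.isSome_iff_exists.1 ih
    exact (ω.child _ _).2 ⟨lam, h, F.m_pos lam⟩

/-- `S^ω(k, α)`, the sum of `Φ^α(T_τ^ω)` over the words `τ` of length `k` of the code tree. -/
def S (k : ℕ) (α : ℝ) : ℝ :=
  ∑ τ ∈ (ω.finite_words k).toFinset, svf α (F.linWord ω.label τ)

/-- The pressure of `ω` at `α` exists and equals `q`. -/
def HasPressure (α q : ℝ) : Prop :=
  Tendsto (fun k : ℕ => Real.log (ω.S k α) / k) atTop (𝓝 q)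

/-- The initial word `i_1 ⋯ i_k` of an infinite word. -/
def initWord (i : ℕ → ℕ) (k : ℕ) : List ℕ := (List.range k).map i

/-- The set `Σ^ω` of infinite paths of the code tree. -/
def paths : Set (ℕ → ℕ) := {i | ∀ k, initWord i k ∈ ω.words}

/-- The code tree fractal `A_a^ω`: the set of all limits `lim_k f_{i_1 ⋯ i_k}^ω(0)` along
infinite paths. -/
def attractor (a : F.Param) : Set (EuclideanSpace ℝ (Fin D)) :=
  {x | ∃ i ∈ ω.paths,
    Tendsto (fun k => F.mapWord a ω.label (initWord i k) 0) atTop (𝓝 x)}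

end CodeTree

/-- Code trees with a list of neck levels `1 ≤ N_1 < N_2 < ⋯`; here `neck n` is `N_{n+1}`.
All sub code trees rooted at a neck level are identical. -/
@[ext]
structure NeckTree {D : ℕ} {Λ : Type*} (F : AffineFamily D Λ) where
  tree : CodeTree F
  neck : ℕ → ℕ
  neck_pos : 0 < neck 0
  neck_strictMono : StrictMono neck
  neck_eq : ∀ (n : ℕ) (i i' j : List ℕ), i.length = neck n → i'.length = neck n →
    i ++ j ∈ tree.words → i' ∈ tree.words →
      i' ++ j ∈ tree.words ∧ tree.label (i ++ j) = tree.label (i' ++ j)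

namespace NeckTree

variable {D : ℕ} {Λ : Type*} {F : AffineFamily D Λ}

/-- The cylinder of all `y` with the same neck levels `N_1, …, N_{n+1}` as `x` and the same
labels as `x` at all levels below `N_{n+1}`. -/
def cylinder (x : NeckTree F) (n : ℕ) : Set (NeckTree F) :=
  {y | (∀ i ≤ n, y.neck i = x.neck i) ∧
    ∀ τ : List ℕ, τ.length < x.neck n → y.tree.label τ = x.tree.label τ}

/-- The topology generated by the cylinders. -/
instance : TopologicalSpace (NeckTree F) :=
  TopologicalSpace.generateFrom {U | ∃ x n, U = cylinder x n}

instance : MeasurableSpace (NeckTree F) := borel _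

instance : BorelSpace (NeckTree F) := ⟨rfl⟩

/-- The map `Ξ`, which passes to the sub code tree rooted at the first neck level `N_1` (the
root is the word of length `N_1` all of whose letters are the first one; by the definition of a
neck level any other word of length `N_1` of the tree gives the same) and replaces the neck
levels by `N_{n+1} - N_1`. -/
def shift (x : NeckTree F) : NeckTree F where
  tree :=
    { label := fun τ => x.tree.label (List.replicate (x.neck 0) 0 ++ τ)
      root := by simpa [CodeTree.words] using x.tree.replicate_mem (x.neck 0)
      child := fun τ l => by
        rw [← List.append_assoc]
        exact x.tree.child _ _ }
  neck := fun n => x.neck (n + 1) - x.neck 0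
  neck_pos := Nat.sub_pos_of_lt (x.neck_strictMono (by simp))
  neck_strictMono := fun a b h => by
    have h1 : x.neck (a + 1) < x.neck (b + 1) := x.neck_strictMono (by omega)
    have h2 : x.neck 0 < x.neck (a + 1) := x.neck_strictMono (by omega)
    show x.neck (a + 1) - x.neck 0 < x.neck (b + 1) - x.neck 0
    omega
  neck_eq := fun n i i' j hi hi' h h' => by
    have h2 : x.neck 0 < x.neck (n + 1) := x.neck_strictMono (by omega)
    have := x.neck_eq (n + 1) (List.replicate (x.neck 0) 0 ++ i)
      (List.replicate (x.neck 0) 0 ++ i') j (by simp; omega) (by simp; omega)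
      (by simpa [CodeTree.words] using h) (by simpa [CodeTree.words] using h')
    simpa [CodeTree.words] using this

end NeckTree

end CodeTreeFractal

end

/-! For similarities `Φ^α(T) = r^α`, where `r` is the ratio, so `Φ^α` is multiplicative along words.
Since all subtrees at a neck coincide, the level sum factorizes there: `S(N_1 + k) = S(N_1) · S(k)`,
with the last factor taken in the shifted tree (`NeckTree.S_neck_add`). Hence `log S(N_n)` and `N_n`
are Birkhoff sums for `Ξ`, and the ergodic theorem gives limits for both divided by `n`. Their
quotient is the pressure along necks; bounded increments of `log S` and gaps `N_{n+1} - N_n = o(n)`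
extend it to all levels. The pressure has slopes in `[log σlo, log σhi]` and is nonnegative at `0`,
so it has exactly one zero `α₀`.

Upper bound, for every translation: if `p(α) < 0`, the natural covers by images of one ball have
`α`-sums tending to `0` (`CodeTree.dimH_attractor_le`).

Lower bound, for `0 < t < min(α₀, D)`: independent blocks between consecutive necks, weighted by
`r^t`, give a measure on paths with mass at most `r_τ^t / S(N_n, t)` on the cylinder of a word `τ`
of length `N_n` (`NeckTree.exists_path_measure`). Its image on the attractor has finite `t`-energy
for almost every translation. Indeed, the difference of two limit points is linear in the
translations, and because `σhi < 1/2` it expands in some class coordinate at a rate comparable to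
the ratio of the common prefix (`AffineFamily.exists_expanding_coordinate`). Integrating the Riesz
kernel over translations therefore costs only `r^(-t)`, which cancels against the measure and leaves
`∑ σlo^(-t(N_{n+1} - N_n)) / S(N_n, t)`. This converges because `p(t) > 0` makes `S(N_n, t)` grow
exponentially in `n`, while the gaps are `o(n)`. -/

namespace CodeTreeFractal

/-! ### Birkhoff's theorem for ergodic maps -/

section Ergodic

variable {X : Type*} {T : X → X} {f : X → ℝ}

/-- The running maximum of `0` and the Birkhoff sums of `f` of positive length at most `n`. -/
def birkhoffMax (T : X → X) (f : X → ℝ) : ℕ → X → ℝ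
  | 0, _ => 0
  | n + 1, x => max 0 (f x + birkhoffMax T f n (T x))

theorem birkhoffMax_nonneg (n : ℕ) (x : X) : 0 ≤ birkhoffMax T f n x := by
  cases n
  · exact le_rfl
  · exact le_max_left _ _

theorem birkhoffMax_le_succ (n : ℕ) : ∀ x, birkhoffMax T f n x ≤ birkhoffMax T f (n + 1) x := by
  induction n with
  | zero => exact fun x => le_max_left _ _
  | succ n ih => exact fun x => max_le_max le_rfl (by gcongr; exact ih _)

theorem birkhoffSum_le_birkhoffMax (n : ℕ) : ∀ x, birkhoffSum T f n x ≤ birkhoffMax T f n x := by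
  induction n with
  | zero => intro x; simp [birkhoffMax]
  | succ n ih =>
    intro x
    rw [birkhoffSum_succ']
    exact le_max_of_le_right (by gcongr; exact ih _)

/-- The recursion `M_{n+1}(x) = max 0 (f x + M_n(T x))` bounds each sequence by the other up to a
constant. The set of points with bounded maxima is thus strictly invariant, and ergodicity applies
to it. -/
theorem bddAbove_birkhoffMax_iff (x : X) :
    BddAbove (Set.range fun n => birkhoffMax T f n (T x)) ↔
      BddAbove (Set.range fun n => birkhoffMax T f n x) := by
  constructor
  · rintro ⟨C, hC⟩
    refine ⟨max 0 (f x + C), ?_⟩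
    rintro _ ⟨n, rfl⟩
    refine (birkhoffMax_le_succ n x).trans ?_
    exact max_le_max le_rfl (by gcongr; exact hC ⟨n, rfl⟩)
  · rintro ⟨C, hC⟩
    refine ⟨C - f x, ?_⟩
    rintro _ ⟨n, rfl⟩
    have h : birkhoffMax T f (n + 1) x ≤ C := hC ⟨n + 1, rfl⟩
    have h' : f x + birkhoffMax T f n (T x) ≤ birkhoffMax T f (n + 1) x := le_max_right _ _
    show birkhoffMax T f n (T x) ≤ C - f x
    linarith

variable [MeasurableSpace X] {μ : Measure X}

theorem measurable_birkhoffMax (hT : Measurable T) (hf : Measurable f) (n : ℕ) :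
    Measurable (birkhoffMax T f n) := by
  induction n with
  | zero => exact measurable_const
  | succ n ih => exact measurable_const.max (hf.add (ih.comp hT))

theorem integrable_birkhoffMax [IsFiniteMeasure μ] (hT : MeasurePreserving T μ μ)
    (hf : Integrable f μ) (n : ℕ) : Integrable (birkhoffMax T f n) μ := by
  induction n with
  | zero => exact integrable_zero _ _ _
  | succ n ih =>
    exact (integrable_zero _ _ _).sup (hf.add (hT.integrable_comp_of_integrable ih))

/-- Otherwise the maxima `M_n` tend to infinity almost everywhere. Then `M_{n+1} - M_n ∘ T = max
(-M_n ∘ T) f` converges to `f`, dominated by `|f|`. By invariance of `μ` its integral is that of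
`M_{n+1} - M_n ≥ 0`, which contradicts the negative integral of `f`. -/
theorem ae_bddAbove_birkhoffSum [IsProbabilityMeasure μ] (hT : Ergodic T μ) (hm : Measurable f)
    (hf : Integrable f μ) (hneg : ∫ x, f x ∂μ < 0) :
    ∀ᵐ x ∂μ, BddAbove (Set.range fun n => birkhoffSum T f n x) := by
  set E : Set X := {x | BddAbove (Set.range fun n => birkhoffMax T f n x)} with hE
  have hEm : MeasurableSet E :=
    measurableSet_bddAbove_range fun n => measurable_birkhoffMax hT.measurable hm n
  have hinv : T ⁻¹' E = E := Set.ext fun x => bddAbove_birkhoffMax_iff x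
  rcases hT.toPreErgodic.ae_mem_or_ae_notMem hEm hinv with h | h
  · filter_upwards [h] with x hx
    obtain ⟨C, hC⟩ := hx
    refine ⟨C, ?_⟩
    rintro _ ⟨n, rfl⟩
    exact (birkhoffSum_le_birkhoffMax n x).trans (hC ⟨n, rfl⟩)
  · exfalso
    have hlim : Tendsto
        (fun n => ∫ x, (birkhoffMax T f (n + 1) x - birkhoffMax T f n (T x)) ∂μ) atTop
        (𝓝 (∫ x, f x ∂μ)) := by
      have key : ∀ n x, birkhoffMax T f (n + 1) x - birkhoffMax T f n (T x) =
          max (-birkhoffMax T f n (T x)) (f x) := by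
        intro n x
        rw [birkhoffMax, ← max_sub_sub_right]
        simp
      refine tendsto_integral_of_dominated_convergence (fun x => |f x|) (fun n => ?_) hf.abs
        (fun n => ?_) ?_
      · exact ((measurable_birkhoffMax hT.measurable hm (n + 1)).sub
          ((measurable_birkhoffMax hT.measurable hm n).comp hT.measurable)).aestronglyMeasurable
      · refine Eventually.of_forall fun x => ?_
        rw [key, Real.norm_eq_abs, abs_le]
        have h0 := birkhoffMax_nonneg (T := T) (f := f) n (T x)
        refine ⟨(neg_abs_le _).trans (le_max_right _ _), max_le ?_ (le_abs_self _)⟩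
        linarith [abs_nonneg (f x)]
      · filter_upwards [h] with x hx
        have hx' : ¬ BddAbove (Set.range fun n => birkhoffMax T f n (T x)) := by
          rwa [bddAbove_birkhoffMax_iff]
        have ht : Tendsto (fun n => birkhoffMax T f n (T x)) atTop atTop := by
          refine (tendsto_atTop_of_monotone (monotone_nat_of_le_succ
            fun n => birkhoffMax_le_succ n (T x))).resolve_right ?_
          rintro ⟨l, hl⟩
          exact hx' hl.bddAbove_range
        refine tendsto_const_nhds.congr' ?_
        filter_upwards [ht.eventually_ge_atTop (-f x)] with n hn
        rw [key, max_eq_right (by linarith)]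
    have hge : ∀ n, 0 ≤ ∫ x, (birkhoffMax T f (n + 1) x - birkhoffMax T f n (T x)) ∂μ := by
      intro n
      have hi := fun n => integrable_birkhoffMax hT.toMeasurePreserving hf n
      have hcomp : ∫ x, birkhoffMax T f n (T x) ∂μ = ∫ x, birkhoffMax T f n x ∂μ := by
        conv_rhs => rw [← hT.toMeasurePreserving.map_eq]
        rw [integral_map hT.measurable.aemeasurable
          (measurable_birkhoffMax hT.measurable hm n).aestronglyMeasurable]
      rw [integral_sub (g := fun x => birkhoffMax T f n (T x)) (hi (n + 1)) (hT.toMeasurePreserving.integrable_comp_of_integrable (hi n)),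
        hcomp, sub_nonneg]
      exact integral_mono (hi n) (hi (n + 1)) (birkhoffMax_le_succ n)
    exact absurd (ge_of_tendsto' hlim hge) (not_le.2 hneg)

/-- For a rational `q` between the mean and `c`, the Birkhoff sums of `f - q` are bounded above, and
the bound disappears after division by `n`. Rational `q` give one null set for all `c`. -/
theorem ae_eventually_birkhoffSum_le [IsProbabilityMeasure μ] (hT : Ergodic T μ)
    (hm : Measurable f) (hf : Integrable f μ) :
    ∀ᵐ x ∂μ, ∀ c, ∫ x, f x ∂μ < c → ∀ᶠ n : ℕ in atTop, birkhoffSum T f n x / n ≤ c := by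
  have h1 : ∀ q : ℚ, ∀ᵐ x ∂μ, ∫ x, f x ∂μ < q →
      BddAbove (Set.range fun n => birkhoffSum T (fun y => f y - q) n x) := by
    intro q
    by_cases hq : ∫ x, f x ∂μ < q
    · have := ae_bddAbove_birkhoffSum hT (hm.sub_const (q : ℝ)) (hf.sub (integrable_const (q : ℝ)))
        (by rw [integral_sub hf (integrable_const _)]; simpa using hq)
      filter_upwards [this] with x hx _ using hx
    · exact Eventually.of_forall fun x hx => absurd hx hq
  filter_upwards [ae_all_iff.2 h1] with x hx c hc
  obtain ⟨q, hq1, hq2⟩ := exists_rat_btwn hc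
  obtain ⟨C, hC⟩ := hx q hq1
  have hlim : Tendsto (fun n : ℕ => C / n) atTop (𝓝 0) := tendsto_const_div_atTop_nhds_zero_nat C
  filter_upwards [hlim.eventually (gt_mem_nhds (sub_pos.2 hq2)), eventually_gt_atTop 0]
    with n hn hn0
  have h2 : birkhoffSum T (fun y => f y - q) n x ≤ C := hC ⟨n, rfl⟩
  have h3 : birkhoffSum T (fun y => f y - q) n x = birkhoffSum T f n x - n * q := by
    simp [birkhoffSum, Finset.sum_sub_distrib]
  have hn0' : (0 : ℝ) < n := by exact_mod_cast hn0
  rw [div_le_iff₀ hn0']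
  rw [div_lt_iff₀ hn0'] at hn
  rw [h3] at h2
  nlinarith

/-- Birkhoff's pointwise ergodic theorem for an ergodic transformation. -/
theorem ae_tendsto_birkhoffSum_div [IsProbabilityMeasure μ] (hT : Ergodic T μ)
    (hm : Measurable f) (hf : Integrable f μ) :
    ∀ᵐ x ∂μ, Tendsto (fun n : ℕ => birkhoffSum T f n x / n) atTop (𝓝 (∫ x, f x ∂μ)) := by
  filter_upwards [ae_eventually_birkhoffSum_le hT hm hf,
    ae_eventually_birkhoffSum_le hT hm.neg hf.neg] with x h1 h2
  rw [Metric.tendsto_nhds]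
  intro ε hε
  have h2' := h2 (-(∫ x, f x ∂μ) + ε / 2) (by
    simp only [Pi.neg_apply, integral_neg]; linarith)
  filter_upwards [h1 (∫ x, f x ∂μ + ε / 2) (by linarith), h2'] with n hn1 hn2
  have h3 : birkhoffSum T (-f) n x = -birkhoffSum T f n x := by simp [birkhoffSum]
  rw [h3, neg_div] at hn2
  rw [Real.dist_eq, abs_lt]
  constructor <;> linarith

end Ergodic

end CodeTreeFractal

/-! ### Similarities: singular values and ratios of words -/

noncomputable section

namespace CodeTreeFractal

/-- An eigenvector `v` of `T* T` for `σ_n ^ 2` satisfies `σ_n ^ 2 ‖v‖ ^ 2 = ‖T v‖ ^ 2 = r ^ 2 ‖v‖ ^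
2`. -/
theorem singularValues_of_norm_map {D : ℕ}
    {T : EuclideanSpace ℝ (Fin D) →ₗ[ℝ] EuclideanSpace ℝ (Fin D)} {r : ℝ} (hr : 0 ≤ r)
    (h : ∀ v, ‖T v‖ = r * ‖v‖) {n : ℕ} (hn : n < D) : T.singularValues n = r := by
  obtain ⟨v, hv⟩ := (T.hasEigenvalue_adjoint_comp_self_sq_singularValues
    (n := n) (by simpa using hn)).exists_hasEigenvector
  have h1 : inner ℝ ((LinearMap.adjoint T ∘ₗ T) v) v = ‖T v‖ ^ 2 := by
    rw [LinearMap.comp_apply, LinearMap.adjoint_inner_left, real_inner_self_eq_norm_sq]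
  rw [hv.apply_eq_smul, real_inner_smul_left, real_inner_self_eq_norm_sq, h, mul_pow] at h1
  have hv0 : ‖v‖ ^ 2 ≠ 0 := by simpa using hv.2
  have := mul_right_cancel₀ hv0 h1
  exact (sq_eq_sq₀ (T.singularValues_nonneg n) hr).1 this

/-- All `D` singular values equal `r`, and in both branches of the definition the exponents add up
to `α`. -/
theorem svf_of_norm_map {D : ℕ} (hD : 1 ≤ D)
    {T : EuclideanSpace ℝ (Fin D) →ₗ[ℝ] EuclideanSpace ℝ (Fin D)} {r : ℝ} (hr : 0 < r)
    (h : ∀ v, ‖T v‖ = r * ‖v‖) {α : ℝ} (hα : 0 ≤ α) : svf α T = r ^ α := by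
  have hs : ∀ n < D, T.singularValues n = r := fun n hn => singularValues_of_norm_map hr.le h hn
  have hp : ∀ n ≤ D, ∏ j ∈ Finset.range n, T.singularValues j = r ^ n := by
    intro n hn
    rw [Finset.prod_congr rfl fun j hj => hs j ((Finset.mem_range.1 hj).trans_le hn)]
    simp
  rw [svf]
  split_ifs with hlt
  · have hfl : ⌊α⌋₊ < D := (Nat.floor_lt hα).2 hlt
    rw [hp _ hfl.le, hs _ hfl, ← Real.rpow_natCast, ← Real.rpow_add hr]
    congr 1
    ring
  · rw [hp _ (Nat.sub_le _ _), hs _ (Nat.sub_lt hD one_pos), ← Real.rpow_natCast,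
      ← Real.rpow_add hr]
    congr 1
    push_cast [Nat.cast_sub hD]
    ring

theorem norm_map_of_isSimilarity {D : ℕ} (hD : 1 ≤ D)
    {T : EuclideanSpace ℝ (Fin D) →ₗ[ℝ] EuclideanSpace ℝ (Fin D)} (h : IsSimilarity T)
    (v : EuclideanSpace ℝ (Fin D)) : ‖T v‖ = T.singularValues 0 * ‖v‖ := by
  obtain ⟨r, hr, h⟩ := h
  have h' : ∀ v, ‖T v‖ = r * ‖v‖ := fun v => by simpa using h v 0
  rw [singularValues_of_norm_map hr.le h' hD, h']

namespace AffineFamily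

variable {D : ℕ} {Λ : Type*} (F : AffineFamily D Λ)

/-- The similarity ratio of the map with letter `i` in the system with label `o`. -/
def ratio (o : Option Λ) (i : ℕ) : ℝ := (F.lin o i).singularValues 0

theorem ratio_nonneg (o : Option Λ) (i : ℕ) : 0 ≤ F.ratio o i :=
  LinearMap.singularValues_nonneg _ _

/-- The number of maps of the system with label `o`. -/
def deg (o : Option Λ) : ℕ := o.elim 0 F.m

/-- The product of the similarity ratios along a word. -/
def ratioWord : (List ℕ → Option Λ) → List ℕ → ℝ
  | _, [] => 1
  | g, i :: w => F.ratio (g []) i * ratioWord (fun τ => g (i :: τ)) w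

theorem ratioWord_nonneg (w : List ℕ) : ∀ g : List ℕ → Option Λ, 0 ≤ F.ratioWord g w := by
  induction w with
  | nil => intro g; simp [ratioWord]
  | cons i w ih => intro g; exact mul_nonneg (F.ratio_nonneg _ _) (ih _)

/-- All maps of the family are similarities, with ratios in `[σlo, σhi]`, where
`0 < σlo ≤ σhi < 1 / 2`. -/
structure IsUniformlySimilar (σlo σhi : ℝ) : Prop where
  dim_pos : 1 ≤ D
  lo_pos : 0 < σlo
  lo_le_hi : σlo ≤ σhi
  hi_lt : σhi < 1 / 2
  norm_map : ∀ lam i v, ‖F.T lam i v‖ = (F.T lam i).singularValues 0 * ‖v‖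
  ratio_mem : ∀ lam i, (F.T lam i).singularValues 0 ∈ Set.Icc σlo σhi

variable {F}

theorem ratioWord_append (v : List ℕ) : ∀ (g : List ℕ → Option Λ) (w : List ℕ),
    F.ratioWord g (v ++ w) = F.ratioWord g v * F.ratioWord (fun τ => g (v ++ τ)) w := by
  induction v with
  | nil => intro g w; simp [ratioWord]
  | cons i v ih => intro g w; simp [ratioWord, ih, mul_assoc]

theorem ratioWord_concat (g : List ℕ → Option Λ) (v : List ℕ) (i : ℕ) :
    F.ratioWord g (v ++ [i]) = F.ratioWord g v * F.ratio (g v) i := by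
  simp [ratioWord_append, ratioWord]

theorem mapWord_eq (a : F.Param) (w : List ℕ) : ∀ (g : List ℕ → Option Λ)
    (x : EuclideanSpace ℝ (Fin D)), F.mapWord a g w x = F.linWord g w x + F.mapWord a g w 0 := by
  induction w with
  | nil => intro g x; simp [mapWord, linWord]
  | cons i w ih =>
    intro g x
    simp only [mapWord, linWord, LinearMap.comp_apply]
    rw [ih, map_add, add_assoc]

theorem mapWord_append (a : F.Param) (v : List ℕ) : ∀ (g : List ℕ → Option Λ) (w : List ℕ)
    (x : EuclideanSpace ℝ (Fin D)),
    F.mapWord a g (v ++ w) x = F.mapWord a g v (F.mapWord a (fun τ => g (v ++ τ)) w x) := by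
  induction v with
  | nil => intro g w x; simp [mapWord]
  | cons i v ih => intro g w x; simp [mapWord, ih]

theorem mapWord_concat_zero (a : F.Param) (g : List ℕ → Option Λ) (w : List ℕ) (i : ℕ) :
    F.mapWord a g (w ++ [i]) 0 = F.mapWord a g w 0 + F.linWord g w (F.trans a (g w) i) := by
  rw [mapWord_append, mapWord_eq, add_comm]
  simp [mapWord]

namespace IsUniformlySimilar

variable {σlo σhi : ℝ} (hF : F.IsUniformlySimilar σlo σhi)

include hF

theorem hi_pos : 0 < σhi := hF.lo_pos.trans_le hF.lo_le_hi

theorem hi_lt_one : σhi < 1 := by linarith [hF.hi_lt]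

theorem lo_lt_one : σlo < 1 := hF.lo_le_hi.trans_lt hF.hi_lt_one

theorem norm_lin (o : Option Λ) (i : ℕ) (v : EuclideanSpace ℝ (Fin D)) :
    ‖F.lin o i v‖ = F.ratio o i * ‖v‖ := by
  rcases o with _ | lam
  · simp [ratio, lin]
  · by_cases h : i < F.m lam
    · simpa [ratio, lin, h] using hF.norm_map lam ⟨i, h⟩ v
    · simp [ratio, lin, h]

theorem ratio_le (o : Option Λ) (i : ℕ) : F.ratio o i ≤ σhi := by
  rcases o with _ | lam
  · simpa [ratio, lin] using hF.hi_pos.le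
  · by_cases h : i < F.m lam
    · simpa [ratio, lin, h] using (hF.ratio_mem lam ⟨i, h⟩).2
    · simpa [ratio, lin, h] using hF.hi_pos.le

theorem le_ratio {o : Option Λ} {i : ℕ} (h : i < F.deg o) : σlo ≤ F.ratio o i := by
  rcases o with _ | lam
  · simp [deg] at h
  · simp only [deg, Option.elim] at h
    simpa [ratio, lin, h] using (hF.ratio_mem lam ⟨i, h⟩).1

theorem norm_linWord (w : List ℕ) : ∀ (g : List ℕ → Option Λ) (v : EuclideanSpace ℝ (Fin D)),
    ‖F.linWord g w v‖ = F.ratioWord g w * ‖v‖ := by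
  induction w with
  | nil => intro g v; simp [linWord, ratioWord]
  | cons i w ih =>
    intro g v
    rw [linWord, LinearMap.comp_apply, hF.norm_lin, ih, ratioWord, mul_assoc]

theorem ratioWord_le (w : List ℕ) : ∀ g : List ℕ → Option Λ,
    F.ratioWord g w ≤ σhi ^ w.length := by
  induction w with
  | nil => intro g; simp [ratioWord]
  | cons i w ih =>
    intro g
    rw [ratioWord, List.length_cons, pow_succ']
    exact mul_le_mul (hF.ratio_le _ _) (ih _) (F.ratioWord_nonneg _ _) hF.hi_pos.le

end IsUniformlySimilar

end AffineFamily

/-! ### Level sums of a code tree -/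

namespace CodeTree

variable {D : ℕ} {Λ : Type*} {F : AffineFamily D Λ} (ω : CodeTree F)

/-- The words of length `k` of a code tree. -/
def level (k : ℕ) : Finset (List ℕ) := (ω.finite_words k).toFinset

variable {ω}

theorem mem_level {k : ℕ} {τ : List ℕ} : τ ∈ ω.level k ↔ τ ∈ ω.words ∧ τ.length = k := by
  simp [level]

theorem concat_mem_words {τ : List ℕ} {l : ℕ} :
    τ ++ [l] ∈ ω.words ↔ l < F.deg (ω.label τ) := by
  rw [words, Set.mem_ofPred_eq, ω.child]
  cases ω.label τ <;> simp [AffineFamily.deg]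

theorem mem_words_of_concat {τ : List ℕ} {l : ℕ} (h : τ ++ [l] ∈ ω.words) : τ ∈ ω.words := by
  obtain ⟨lam, h1, -⟩ := (ω.child τ l).1 h
  simp [words, h1]

theorem mem_words_of_append {τ w : List ℕ} (h : τ ++ w ∈ ω.words) : τ ∈ ω.words := by
  induction w using List.reverseRecOn with
  | nil => simpa using h
  | append_singleton w l ih =>
    rw [← List.append_assoc] at h
    exact ih (mem_words_of_concat h)

theorem level_nonempty (k : ℕ) : (ω.level k).Nonempty :=
  ⟨_, mem_level.2 ⟨ω.replicate_mem k, by simp⟩⟩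

theorem level_zero : ω.level 0 = {[]} := by
  ext τ
  rw [mem_level]
  constructor
  · rintro ⟨-, h⟩; simpa using h
  · intro h
    rw [Finset.mem_singleton.1 h]
    exact ⟨ω.root, rfl⟩

theorem deg_pos {τ : List ℕ} (h : τ ∈ ω.words) : 0 < F.deg (ω.label τ) := by
  obtain ⟨lam, h⟩ := Option.isSome_iff_exists.1 h
  simpa [AffineFamily.deg, h] using F.m_pos lam

theorem sum_level_succ (k : ℕ) (f : List ℕ → ℝ) :
    ∑ τ ∈ ω.level (k + 1), f τ =
      ∑ τ ∈ ω.level k, ∑ l ∈ Finset.range (F.deg (ω.label τ)), f (τ ++ [l]) := by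
  rw [Finset.sum_sigma']
  symm
  refine Finset.sum_nbij (fun p => p.1 ++ [p.2]) ?_ ?_ ?_ (fun _ _ => rfl)
  · rintro ⟨τ, l⟩ h
    simp only [Finset.mem_sigma, mem_level, Finset.mem_range] at h
    exact mem_level.2 ⟨concat_mem_words.2 h.2, by simp [h.1.2]⟩
  · rintro ⟨τ, l⟩ - ⟨τ', l'⟩ - h
    have h' : τ ++ [l] = τ' ++ [l'] := h
    obtain ⟨h1, h2⟩ := List.append_inj' h' rfl
    simp_all
  · intro τ h
    rw [Finset.mem_coe, mem_level] at h
    rcases List.eq_nil_or_concat' τ with rfl | ⟨σ, l, rfl⟩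
    · simp at h
    · refine ⟨⟨σ, l⟩, ?_, rfl⟩
      simp only [Finset.coe_sigma, Set.mem_sigma_iff, Finset.mem_coe, mem_level, Finset.mem_range]
      exact ⟨⟨mem_words_of_concat h.1, by simpa using h.2⟩, concat_mem_words.1 h.1⟩

variable {σlo σhi : ℝ} (hF : F.IsUniformlySimilar σlo σhi)

include hF

theorem le_ratioWord {τ : List ℕ} (h : τ ∈ ω.words) :
    σlo ^ τ.length ≤ F.ratioWord ω.label τ := by
  induction τ using List.reverseRecOn with
  | nil => simp [AffineFamily.ratioWord]
  | append_singleton τ l ih =>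
    rw [AffineFamily.ratioWord_concat, List.length_append, List.length_singleton, pow_succ]
    exact mul_le_mul (ih (mem_words_of_concat h)) (hF.le_ratio (concat_mem_words.1 h))
      hF.lo_pos.le (F.ratioWord_nonneg _ _)

theorem ratioWord_pos {τ : List ℕ} (h : τ ∈ ω.words) : 0 < F.ratioWord ω.label τ :=
  (pow_pos hF.lo_pos _).trans_le (le_ratioWord hF h)

theorem S_eq (k : ℕ) {α : ℝ} (hα : 0 ≤ α) :
    ω.S k α = ∑ τ ∈ ω.level k, F.ratioWord ω.label τ ^ α :=
  Finset.sum_congr rfl fun _ hτ => svf_of_norm_map hF.dim_pos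
    (ratioWord_pos hF (mem_level.1 hτ).1) (hF.norm_linWord _ _) hα

theorem S_pos (k : ℕ) {α : ℝ} (hα : 0 ≤ α) : 0 < ω.S k α := by
  rw [S_eq hF k hα]
  exact Finset.sum_pos (fun τ hτ => Real.rpow_pos_of_pos (ratioWord_pos hF (mem_level.1 hτ).1) _)
    (level_nonempty k)

theorem S_zero {α : ℝ} (hα : 0 ≤ α) : ω.S 0 α = 1 := by
  simp [S_eq hF 0 hα, level_zero, AffineFamily.ratioWord]

theorem S_succ (k : ℕ) {α : ℝ} (hα : 0 ≤ α) :
    ω.S (k + 1) α = ∑ τ ∈ ω.level k, F.ratioWord ω.label τ ^ α *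
      ∑ l ∈ Finset.range (F.deg (ω.label τ)), F.ratio (ω.label τ) l ^ α := by
  rw [S_eq hF _ hα, sum_level_succ]
  refine Finset.sum_congr rfl fun τ _ => ?_
  rw [Finset.mul_sum]
  refine Finset.sum_congr rfl fun l _ => ?_
  rw [AffineFamily.ratioWord_concat,
    Real.mul_rpow (F.ratioWord_nonneg _ _) (F.ratio_nonneg _ _)]

/-- Every word has the child with letter `0`, of ratio at least `σlo`. Together with `S_succ_le`
this bounds the increments of `log S`, which is what interpolation between neck levels needs. -/
theorem le_S_succ (k : ℕ) {α : ℝ} (hα : 0 ≤ α) : σlo ^ α * ω.S k α ≤ ω.S (k + 1) α := by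
  rw [S_succ hF k hα, S_eq hF k hα, mul_comm, Finset.sum_mul]
  refine Finset.sum_le_sum fun τ hτ => ?_
  gcongr
  · exact Real.rpow_nonneg (F.ratioWord_nonneg _ _) _
  · have hd := deg_pos (mem_level.1 hτ).1
    calc σlo ^ α ≤ F.ratio (ω.label τ) 0 ^ α := by
          have := hF.lo_pos
          gcongr
          exact hF.le_ratio hd
      _ ≤ _ := Finset.single_le_sum
          (f := fun l => F.ratio (ω.label τ) l ^ α)
          (fun l _ => Real.rpow_nonneg (F.ratio_nonneg _ _) _) (Finset.mem_range.2 hd)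

theorem S_succ_le {M : ℕ} (hM : ∀ lam, F.m lam ≤ M) (k : ℕ) {α : ℝ} (hα : 0 ≤ α) :
    ω.S (k + 1) α ≤ M * ω.S k α := by
  rw [S_succ hF k hα, S_eq hF k hα, mul_comm, Finset.sum_mul]
  refine Finset.sum_le_sum fun τ hτ => ?_
  gcongr
  · exact Real.rpow_nonneg (F.ratioWord_nonneg _ _) _
  · calc ∑ l ∈ Finset.range (F.deg (ω.label τ)), F.ratio (ω.label τ) l ^ α
        ≤ ∑ l ∈ Finset.range (F.deg (ω.label τ)), (1 : ℝ) := by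
          refine Finset.sum_le_sum fun l _ => Real.rpow_le_one (F.ratio_nonneg _ _)
            ((hF.ratio_le _ _).trans hF.hi_lt_one.le) hα
      _ = F.deg (ω.label τ) := by simp
      _ ≤ M := by
          obtain ⟨lam, h⟩ := Option.isSome_iff_exists.1 (mem_level.1 hτ).1
          simpa [AffineFamily.deg, h] using hM lam

/-- Ratios at level `k` lie between `σlo ^ k` and `σhi ^ k`; apply this to the factor `r ^ (β - α)`
of `r ^ β`. In the limit it confines the slopes of the pressure to `[log σlo, log σhi]`. -/
theorem S_mono_exponent (k : ℕ) {α β : ℝ} (hα : 0 ≤ α) (hαβ : α ≤ β) :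
    (σlo ^ k) ^ (β - α) * ω.S k α ≤ ω.S k β ∧ ω.S k β ≤ (σhi ^ k) ^ (β - α) * ω.S k α := by
  rw [S_eq hF k hα, S_eq hF k (hα.trans hαβ), Finset.mul_sum, Finset.mul_sum]
  have key : ∀ τ ∈ ω.level k, F.ratioWord ω.label τ ^ β =
      F.ratioWord ω.label τ ^ (β - α) * F.ratioWord ω.label τ ^ α := by
    intro τ hτ
    rw [← Real.rpow_add (ratioWord_pos hF (mem_level.1 hτ).1), sub_add_cancel]
  constructor
  · refine Finset.sum_le_sum fun τ hτ => ?_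
    rw [key τ hτ]
    have h := le_ratioWord hF (mem_level.1 hτ).1
    rw [(mem_level.1 hτ).2] at h
    exact mul_le_mul_of_nonneg_right
      (Real.rpow_le_rpow (pow_nonneg hF.lo_pos.le _) h (sub_nonneg.2 hαβ))
      (Real.rpow_nonneg (F.ratioWord_nonneg _ _) _)
  · refine Finset.sum_le_sum fun τ hτ => ?_
    rw [key τ hτ]
    have h := hF.ratioWord_le τ ω.label
    rw [(mem_level.1 hτ).2] at h
    exact mul_le_mul_of_nonneg_right
      (Real.rpow_le_rpow (F.ratioWord_nonneg _ _) h (sub_nonneg.2 hαβ))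
      (Real.rpow_nonneg (F.ratioWord_nonneg _ _) _)

end CodeTree

/-! ### Factorization at the first neck -/

namespace NeckTree

variable {D : ℕ} {Λ : Type*} {F : AffineFamily D Λ} (x : NeckTree F)

/-- The neck condition compares labels only at words of the tree. Off the tree both labels are
`none`, so the two labellings agree as functions and can be substituted for each other. -/
theorem label_append {τ : List ℕ} (hτ : τ ∈ x.tree.level (x.neck 0)) :
    (fun v => x.tree.label (τ ++ v)) = x.shift.tree.label := by
  obtain ⟨h1, h2⟩ := CodeTree.mem_level.1 hτ
  funext v
  show _ = x.tree.label (List.replicate (x.neck 0) 0 ++ v)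
  by_cases h : τ ++ v ∈ x.tree.words
  · exact (x.neck_eq 0 τ (List.replicate (x.neck 0) 0) v h2 (by simp) h
      (x.tree.replicate_mem _)).2
  · by_cases h' : List.replicate (x.neck 0) 0 ++ v ∈ x.tree.words
    · exact absurd (x.neck_eq 0 (List.replicate (x.neck 0) 0) τ v (by simp) h2 h' h1).1 h
    · rw [CodeTree.words, Set.mem_ofPred_eq, Option.isSome_iff_ne_none, not_not] at h h'
      rw [h, h']

theorem append_mem_words {τ : List ℕ} (hτ : τ ∈ x.tree.level (x.neck 0)) (v : List ℕ) :
    τ ++ v ∈ x.tree.words ↔ v ∈ x.shift.tree.words := by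
  have := congrFun (x.label_append hτ) v
  simp only [CodeTree.words, Set.mem_ofPred_eq]
  rw [← this]

theorem ratioWord_append {τ : List ℕ} (hτ : τ ∈ x.tree.level (x.neck 0)) (v : List ℕ) :
    F.ratioWord x.tree.label (τ ++ v) =
      F.ratioWord x.tree.label τ * F.ratioWord x.shift.tree.label v := by
  rw [AffineFamily.ratioWord_append, x.label_append hτ]

theorem sum_level_neck_add (k : ℕ) (f : List ℕ → ℝ) :
    ∑ τ ∈ x.tree.level (x.neck 0 + k), f τ =
      ∑ τ ∈ x.tree.level (x.neck 0), ∑ v ∈ x.shift.tree.level k, f (τ ++ v) := by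
  rw [← Finset.sum_product' (f := fun τ v => f (τ ++ v))]
  symm
  refine Finset.sum_nbij (fun p => p.1 ++ p.2) ?_ ?_ ?_ (fun _ _ => rfl)
  · rintro ⟨τ, v⟩ h
    obtain ⟨h1, h2⟩ := Finset.mem_product.1 h
    rw [CodeTree.mem_level]
    refine ⟨(x.append_mem_words h1 v).2 (CodeTree.mem_level.1 h2).1, ?_⟩
    rw [List.length_append, (CodeTree.mem_level.1 h1).2, (CodeTree.mem_level.1 h2).2]
  · rintro ⟨τ, v⟩ h ⟨τ', v'⟩ h' he
    have h1 := (CodeTree.mem_level.1 (Finset.mem_product.1 h).1).2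
    have h2 := (CodeTree.mem_level.1 (Finset.mem_product.1 h').1).2
    obtain ⟨e1, e2⟩ := List.append_inj (show τ ++ v = τ' ++ v' from he) (h1.trans h2.symm)
    rw [e1, e2]
  · intro w hw
    obtain ⟨h1, h2⟩ := CodeTree.mem_level.1 (Finset.mem_coe.1 hw)
    have e := List.take_append_drop (x.neck 0) w
    have ht : w.take (x.neck 0) ∈ x.tree.level (x.neck 0) := by
      rw [CodeTree.mem_level]
      refine ⟨CodeTree.mem_words_of_append (w := w.drop (x.neck 0)) (by rwa [e]), ?_⟩
      simp [h2]
    refine ⟨(w.take (x.neck 0), w.drop (x.neck 0)), ?_, e⟩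
    rw [Finset.mem_coe, Finset.mem_product]
    refine ⟨ht, CodeTree.mem_level.2 ⟨(x.append_mem_words ht _).1 (by rwa [e]), ?_⟩⟩
    simp [h2]

variable {σlo σhi : ℝ} (hF : F.IsUniformlySimilar σlo σhi)

include hF

/-- Cutting words at the neck is a bijection onto a product, because the tree below the neck does
not depend on the prefix, and ratios multiply. The equality is what makes `log S` at necks an
additive cocycle. -/
theorem S_neck_add (k : ℕ) {α : ℝ} (hα : 0 ≤ α) :
    x.tree.S (x.neck 0 + k) α = x.tree.S (x.neck 0) α * x.shift.tree.S k α := by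
  rw [CodeTree.S_eq hF _ hα, CodeTree.S_eq hF _ hα, CodeTree.S_eq hF _ hα, sum_level_neck_add,
    Finset.sum_mul_sum]
  refine Finset.sum_congr rfl fun τ hτ => Finset.sum_congr rfl fun v _ => ?_
  rw [x.ratioWord_append hτ, Real.mul_rpow (F.ratioWord_nonneg _ _) (F.ratioWord_nonneg _ _)]

end NeckTree

end CodeTreeFractal

end

/-! ### Existence of the pressure and its unique zero -/

noncomputable section

namespace CodeTreeFractal

/-- Both `N (n + 1) / n` and `N n / n` tend to `c`. Gaps between necks may be unbounded, but they
are `o(n)`. -/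
theorem tendsto_succ_sub_div {N : ℕ → ℕ} {c : ℝ}
    (hNc : Tendsto (fun n : ℕ => (N n : ℝ) / n) atTop (𝓝 c)) :
    Tendsto (fun n : ℕ => ((N (n + 1) : ℝ) - N n) / n) atTop (𝓝 0) := by
  have h1 : Tendsto (fun n : ℕ => ((N (n + 1) : ℝ) / (n + 1 : ℕ))) atTop (𝓝 c) :=
    hNc.comp (tendsto_add_atTop_nat 1)
  have h2 : Tendsto (fun n : ℕ => (((n + 1 : ℕ) : ℝ) / n)) atTop (𝓝 1) := by
    have : Tendsto (fun n : ℕ => 1 + 1 / (n : ℝ)) atTop (𝓝 (1 + 0)) :=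
      tendsto_const_nhds.add tendsto_one_div_atTop_nhds_zero_nat
    rw [add_zero] at this
    refine this.congr' ?_
    filter_upwards [eventually_gt_atTop 0] with n hn
    have : (n : ℝ) ≠ 0 := by positivity
    push_cast
    field_simp
  have h3 := (h1.mul h2).sub hNc
  rw [mul_one, sub_self] at h3
  refine h3.congr' ?_
  filter_upwards [eventually_gt_atTop 0] with n hn
  have : (n : ℝ) ≠ 0 := by positivity
  have : ((n + 1 : ℕ) : ℝ) ≠ 0 := by positivity
  field_simp

/-- Convergence of `a k / k` along a sequence of bounded density, with gaps of lower order, passes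
to the whole sequence if `a` has bounded increments. -/
theorem tendsto_div_of_subsequence {N : ℕ → ℕ} (hN : StrictMono N) (hN0 : N 0 = 0) {c : ℝ}
    (hc : 0 < c) (hNc : Tendsto (fun n => (N n : ℝ) / n) atTop (𝓝 c)) {a : ℕ → ℝ} {C L : ℝ}
    (ha : ∀ k, |a (k + 1) - a k| ≤ C) (haL : Tendsto (fun n => a (N n) / n) atTop (𝓝 L)) :
    Tendsto (fun k : ℕ => a k / k) atTop (𝓝 (L / c)) := by
  have hgap := tendsto_succ_sub_div hNc
  have hex : ∀ k, ∃ n, N n ≤ k ∧ k < N (n + 1) := by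
    intro k
    have hk : ∃ n, k < N (n + 1) := ⟨k, hN.le_apply.trans_lt (hN (Nat.lt_succ_self k))⟩
    refine ⟨Nat.find hk, ?_, Nat.find_spec hk⟩
    rcases h : Nat.find hk with _ | m
    · rw [hN0]; exact Nat.zero_le _
    · exact not_lt.1 (Nat.find_min hk (m := m) (by omega))
  choose n hn1 hn2 using hex
  have hn : Tendsto n atTop atTop := by
    refine tendsto_atTop.2 fun m => ?_
    filter_upwards [eventually_ge_atTop (N m)] with k hk
    have := hN.lt_iff_lt.1 (hk.trans_lt (hn2 k))
    omega
  -- The denominator is the index `n k` of the last term of `N` not exceeding `k`. The statement is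
  -- applied both to `a` and to the identity sequence, and the two limits are then divided.
  have key : ∀ (a : ℕ → ℝ) (C L : ℝ), (∀ k, |a (k + 1) - a k| ≤ C) →
      Tendsto (fun n => a (N n) / n) atTop (𝓝 L) →
      Tendsto (fun k => a k / n k) atTop (𝓝 L) := by
    intro a C L ha haL
    have hinc : ∀ k l, |a (k + l) - a k| ≤ C * l := by
      intro k l
      induction l with
      | zero => simp
      | succ l ih =>
        have h := abs_add_le (a (k + l + 1) - a (k + l)) (a (k + l) - a k)
        rw [sub_add_sub_cancel] at h
        have := ha (k + l)
        rw [← add_assoc]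
        push_cast
        linarith
    have hC : 0 ≤ C := (abs_nonneg _).trans (ha 0)
    have h0 : Tendsto (fun k => (a k - a (N (n k))) / n k) atTop (𝓝 0) := by
      have h1 := (hgap.comp hn).const_mul C
      rw [mul_zero] at h1
      refine squeeze_zero_norm (fun k => ?_) h1
      obtain ⟨l, hl⟩ := Nat.exists_eq_add_of_le (hn1 k)
      have h2 := hinc (N (n k)) l
      rw [← hl] at h2
      rw [Real.norm_eq_abs, abs_div, Nat.abs_cast, Function.comp_apply, ← mul_div_assoc]
      gcongr
      refine h2.trans ?_
      gcongr
      have h3 : (k : ℝ) ≤ N (n k + 1) := by exact_mod_cast (hn2 k).le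
      have h4 : (k : ℝ) = N (n k) + l := by exact_mod_cast hl
      linarith
    have h2 := (haL.comp hn).add h0
    rw [add_zero] at h2
    refine h2.congr fun k => ?_
    rw [Function.comp_apply, ← add_div, add_sub_cancel]
  have hk := key (fun k => (k : ℝ)) 1 c (fun k => by simp) hNc
  refine ((key a C L ha haL).div hk hc.ne').congr' ?_
  filter_upwards [hn.eventually_gt_atTop 0] with k hk
  have : ((n k : ℕ) : ℝ) ≠ 0 := by positivity
  exact div_div_div_cancel_right₀ this _ _

namespace AffineFamily

variable {D : ℕ} {Λ : Type*} {F : AffineFamily D Λ}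

theorem linWord_congr (w : List ℕ) : ∀ {g g' : List ℕ → Option Λ},
    (∀ v : List ℕ, v.length < w.length → g v = g' v) → F.linWord g w = F.linWord g' w := by
  induction w with
  | nil => intro g g' _; rfl
  | cons i w ih =>
    intro g g' h
    rw [linWord, linWord, h [] (by simp), ih fun v hv => h (i :: v) (by simpa using hv)]

end AffineFamily

namespace CodeTree

variable {D : ℕ} {Λ : Type*} {F : AffineFamily D Λ}

theorem level_congr {ω ω' : CodeTree F} {k : ℕ}
    (h : ∀ τ : List ℕ, τ.length < k → ω.label τ = ω'.label τ) : ω.level k = ω'.level k := by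
  rcases k with _ | k
  · rw [level_zero, level_zero]
  · ext τ
    rw [mem_level, mem_level]
    refine and_congr_left fun hl => ?_
    rcases List.eq_nil_or_concat' τ with rfl | ⟨σ, l, rfl⟩
    · simp at hl
    · rw [concat_mem_words, concat_mem_words, h σ (by simp at hl; omega)]

/-- The level sum reads only labels of words shorter than `k`, which are those fixed by a cylinder
when `k` is a neck. Measurability of `log S(N_1)` follows from this. -/
theorem S_congr {ω ω' : CodeTree F} {k : ℕ} (α : ℝ)
    (h : ∀ τ : List ℕ, τ.length < k → ω.label τ = ω'.label τ) : ω.S k α = ω'.S k α := by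
  refine Finset.sum_congr (level_congr h) fun τ hτ => ?_
  have hl := (mem_level.1 (show τ ∈ ω'.level k from hτ)).2
  rw [AffineFamily.linWord_congr τ fun v hv => h v (hl ▸ hv)]

variable {ω : CodeTree F} {σlo σhi : ℝ} (hF : F.IsUniformlySimilar σlo σhi)

include hF

theorem log_S_zero {α : ℝ} (hα : 0 ≤ α) : Real.log (ω.S 0 α) = 0 := by
  rw [S_zero hF hα, Real.log_one]

theorem abs_log_S_succ_sub_le {M : ℕ} (hM : ∀ lam, F.m lam ≤ M) {α : ℝ} (hα : 0 ≤ α) (k : ℕ) :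
    |Real.log (ω.S (k + 1) α) - Real.log (ω.S k α)| ≤
      |α * Real.log σlo| + |Real.log M| := by
  have h0 := S_pos (ω := ω) hF k hα
  have h1 := S_pos (ω := ω) hF (k + 1) hα
  have hM0 : (0 : ℝ) < M := by
    have := S_succ_le (ω := ω) hF hM k hα
    by_contra hneg
    nlinarith [(Nat.cast_nonneg M : (0 : ℝ) ≤ M)]
  have hlo : 0 < σlo ^ α := Real.rpow_pos_of_pos hF.lo_pos α
  have h2 := Real.log_le_log (by positivity) (le_S_succ (ω := ω) hF k hα)
  have h3 := Real.log_le_log h1 (S_succ_le (ω := ω) hF hM k hα)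
  rw [Real.log_mul hlo.ne' h0.ne', Real.log_rpow hF.lo_pos] at h2
  rw [Real.log_mul hM0.ne' h0.ne'] at h3
  rw [abs_le]
  constructor
  · linarith [neg_abs_le (α * Real.log σlo), abs_nonneg (Real.log M)]
  · linarith [le_abs_self (Real.log M), abs_nonneg (α * Real.log σlo)]

theorem abs_log_S_le {M : ℕ} (hM : ∀ lam, F.m lam ≤ M) {α : ℝ} (hα : 0 ≤ α) (k : ℕ) :
    |Real.log (ω.S k α)| ≤ (|α * Real.log σlo| + |Real.log M|) * k := by
  induction k with
  | zero => simp [log_S_zero hF hα]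
  | succ k ih =>
    have h := abs_add_le (Real.log (ω.S (k + 1) α) - Real.log (ω.S k α)) (Real.log (ω.S k α))
    rw [sub_add_cancel] at h
    have := abs_log_S_succ_sub_le (ω := ω) hF hM hα k
    push_cast
    linarith

theorem log_S_sub_mem {α β : ℝ} (hα : 0 ≤ α) (hαβ : α ≤ β) (k : ℕ) :
    (β - α) * Real.log σlo * k ≤ Real.log (ω.S k β) - Real.log (ω.S k α) ∧
      Real.log (ω.S k β) - Real.log (ω.S k α) ≤ (β - α) * Real.log σhi * k := by
  obtain ⟨h1, h2⟩ := S_mono_exponent (ω := ω) hF k hα hαβ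
  have h0 := S_pos (ω := ω) hF k hα
  have h0' := S_pos (ω := ω) hF k (hα.trans hαβ)
  have hlo := pow_pos hF.lo_pos k
  have hhi := pow_pos hF.hi_pos k
  have h3 := Real.log_le_log (by positivity) h1
  have h4 := Real.log_le_log h0' h2
  rw [Real.log_mul (by positivity) h0.ne', Real.log_rpow hlo, Real.log_pow] at h3
  rw [Real.log_mul (by positivity) h0.ne', Real.log_rpow hhi, Real.log_pow] at h4
  constructor
  · linarith
  · linarith

theorem HasPressure.sub_mem {α β q r : ℝ} (hα : 0 ≤ α) (hαβ : α ≤ β) (hq : ω.HasPressure α q)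
    (hr : ω.HasPressure β r) :
    (β - α) * Real.log σlo ≤ r - q ∧ r - q ≤ (β - α) * Real.log σhi := by
  have h : Tendsto (fun k : ℕ => Real.log (ω.S k β) / k - Real.log (ω.S k α) / k) atTop
      (𝓝 (r - q)) := Tendsto.sub hr hq
  constructor
  · refine ge_of_tendsto h ?_
    filter_upwards [eventually_gt_atTop 0] with k hk
    rw [← sub_div, le_div_iff₀ (by exact_mod_cast hk)]
    exact (log_S_sub_mem hF hα hαβ k).1
  · refine le_of_tendsto h ?_
    filter_upwards [eventually_gt_atTop 0] with k hk
    rw [← sub_div, div_le_iff₀ (by exact_mod_cast hk)]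
    exact (log_S_sub_mem hF hα hαβ k).2

theorem HasPressure.nonneg {q : ℝ} (hq : ω.HasPressure 0 q) : 0 ≤ q := by
  refine ge_of_tendsto' hq fun k => div_nonneg (Real.log_nonneg ?_) (Nat.cast_nonneg k)
  rw [S_eq hF k le_rfl]
  simpa using (level_nonempty (ω := ω) k).card_pos

/-- The slope bounds make `p` Lipschitz and strictly decreasing, and `p 0 ≥ 0` because level sums at
exponent `0` count words. The intermediate value theorem supplies the zero. -/
theorem exists_unique_zero_of_hasPressure {p : ℝ → ℝ}
    (hp : ∀ α, 0 ≤ α → ω.HasPressure α (p α)) :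
    ∃ α₀, 0 ≤ α₀ ∧ ∀ α, 0 ≤ α → (p α = 0 ↔ α = α₀) := by
  have hmem : ∀ α β, 0 ≤ α → α ≤ β → (β - α) * Real.log σlo ≤ p β - p α ∧
      p β - p α ≤ (β - α) * Real.log σhi := fun α β hα hαβ =>
    (hp α hα).sub_mem hF hα hαβ (hp β (hα.trans hαβ))
  have hhi : Real.log σhi < 0 := Real.log_neg hF.hi_pos hF.hi_lt_one
  have hlo : Real.log σlo < 0 := Real.log_neg hF.lo_pos hF.lo_lt_one
  have h0 : 0 ≤ p 0 := (hp 0 le_rfl).nonneg hF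
  -- Starting from `p 0` and descending with slope at most `log σhi`, the pressure is nonpositive at
  -- `b`.
  set b : ℝ := p 0 / -Real.log σhi with hb
  have hb0 : 0 ≤ b := div_nonneg h0 (neg_nonneg.2 hhi.le)
  have hpb : p b ≤ 0 := by
    have h := (hmem 0 b le_rfl hb0).2
    have h' : b * Real.log σhi = -p 0 := by
      rw [hb, div_neg, neg_mul, div_mul_cancel₀ _ hhi.ne]
    rw [sub_zero, h'] at h
    linarith
  have hcont : ContinuousOn p (Set.Icc 0 b) := by
    have : LipschitzOnWith (Real.toNNReal (-Real.log σlo)) p (Set.Icc 0 b) := by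
      refine LipschitzOnWith.of_dist_le_mul fun α hα β hβ => ?_
      rw [Real.coe_toNNReal _ (neg_nonneg.2 hlo.le)]
      wlog hle : α ≤ β generalizing α β
      · rw [dist_comm, dist_comm α]
        exact this β hβ α hα (le_of_not_ge hle)
      · obtain ⟨h1, h2⟩ := hmem α β hα.1 hle
        rw [dist_comm, dist_comm α, Real.dist_eq, Real.dist_eq, abs_of_nonneg (sub_nonneg.2 hle),
          abs_of_nonpos]
        · linarith
        · exact h2.trans (mul_nonpos_of_nonneg_of_nonpos (sub_nonneg.2 hle) hhi.le)
    exact this.continuousOn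
  obtain ⟨α₀, hα₀, hz⟩ := intermediate_value_Icc' hb0 hcont ⟨hpb, h0⟩
  refine ⟨α₀, hα₀.1, fun α hα => ⟨fun h => ?_, fun h => h ▸ hz⟩⟩
  by_contra hne
  rcases lt_or_gt_of_ne hne with hlt | hlt
  · have := (hmem α α₀ hα hlt.le).2
    nlinarith [mul_neg_of_pos_of_neg (sub_pos.2 hlt) hhi]
  · have := (hmem α₀ α hα₀.1 hlt.le).2
    nlinarith [mul_neg_of_pos_of_neg (sub_pos.2 hlt) hhi]

/-- Existence of the pressure at all nonnegative rational exponents gives it everywhere. -/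
theorem hasPressure_of_dense {p : ℝ → ℝ} {α : ℝ} (hα : 0 ≤ α)
    (hq : ∀ q : ℚ, 0 ≤ q → ω.HasPressure q (p q))
    (hp : ∀ β, α ≤ β → |p β - p α| ≤ (β - α) * -Real.log σlo) : ω.HasPressure α (p α) := by
  have hhi : Real.log σhi < 0 := Real.log_neg hF.hi_pos hF.hi_lt_one
  have hlo : Real.log σlo < 0 := Real.log_neg hF.lo_pos hF.lo_lt_one
  rw [HasPressure, Metric.tendsto_nhds]
  intro ε hε
  have hK : 0 < -Real.log σlo := neg_pos.2 hlo
  -- The exponent `q` is so close to `α` that replacing `α` by `q` costs less than `ε / 3` in the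
  -- level sums and again in `p`; the last third is the convergence at `q`.
  obtain ⟨q, hq1, hq2⟩ := exists_rat_btwn
    (show α < α + ε / 3 / -Real.log σlo by linarith [div_pos (div_pos hε three_pos) hK])
  have hq0 : (0 : ℚ) ≤ q := by exact_mod_cast hα.trans hq1.le
  have hsmall : ((q : ℝ) - α) * -Real.log σlo < ε / 3 := by
    rw [← lt_div_iff₀ hK]
    linarith
  filter_upwards [(Metric.tendsto_nhds.1 (hq q hq0)) (ε / 3) (by positivity),
    eventually_gt_atTop 0] with k hk hk0
  have hk0' : (0 : ℝ) < k := by exact_mod_cast hk0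
  obtain ⟨h1, h2⟩ := log_S_sub_mem (ω := ω) hF hα hq1.le k
  have h3 : |Real.log (ω.S k q) / k - Real.log (ω.S k α) / k| ≤
      ((q : ℝ) - α) * -Real.log σlo := by
    rw [← sub_div, abs_div, Nat.abs_cast, div_le_iff₀ hk0', abs_of_nonpos]
    · linarith
    · refine h2.trans (mul_nonpos_of_nonpos_of_nonneg ?_ hk0'.le)
      exact mul_nonpos_of_nonneg_of_nonpos (by linarith) hhi.le
  have h4 := hp q hq1.le
  rw [Real.dist_eq] at hk ⊢
  rw [abs_lt] at hk ⊢
  rw [abs_le] at h3 h4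
  constructor <;> linarith [h3.1, h3.2, h4.1, h4.2, hk.1, hk.2]

end CodeTree

namespace NeckTree

variable {D : ℕ} {Λ : Type*} {F : AffineFamily D Λ}

theorem mem_cylinder_self (x : NeckTree F) (n : ℕ) : x ∈ cylinder x n :=
  ⟨fun _ _ => rfl, fun _ _ => rfl⟩

/-- Such a function is locally constant, so the preimage of any set is a union of cylinders and
hence open. -/
theorem measurable_of_eq_on_cylinder {β : Type*} [MeasurableSpace β] {f : NeckTree F → β}
    (h : ∀ x, ∃ n, ∀ y ∈ cylinder x n, f y = f x) : Measurable f := by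
  intro s _
  refine IsOpen.measurableSet ?_
  choose n hn using h
  have : f ⁻¹' s = ⋃ x ∈ f ⁻¹' s, cylinder x (n x) := by
    ext y
    simp only [Set.mem_iUnion, exists_prop]
    constructor
    · exact fun hy => ⟨y, hy, mem_cylinder_self y _⟩
    · rintro ⟨x, hx, hy⟩
      rw [Set.mem_preimage, hn x y hy]
      exact hx
  rw [this]
  exact isOpen_biUnion fun x _ => TopologicalSpace.isOpen_generateFrom_of_mem ⟨x, _, rfl⟩

/-- The neck levels, preceded by level `0`. -/
def neckLevel (x : NeckTree F) : ℕ → ℕ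
  | 0 => 0
  | n + 1 => x.neck n

theorem neckLevel_strictMono (x : NeckTree F) : StrictMono x.neckLevel := by
  refine strictMono_nat_of_lt_succ fun n => ?_
  rcases n with _ | n
  · exact x.neck_pos
  · exact x.neck_strictMono (Nat.lt_succ_self n)

theorem neckLevel_succ (x : NeckTree F) (n : ℕ) :
    x.neckLevel (n + 1) = x.neck 0 + x.shift.neckLevel n := by
  rcases n with _ | n
  · rfl
  · have : x.neck 0 < x.neck (n + 1) := x.neck_strictMono n.succ_pos
    show x.neck (n + 1) = x.neck 0 + (x.neck (n + 1) - x.neck 0)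
    omega

theorem birkhoffSum_neck (n : ℕ) : ∀ x : NeckTree F,
    birkhoffSum shift (fun y : NeckTree F => (y.neck 0 : ℝ)) n x = x.neckLevel n := by
  induction n with
  | zero => intro x; simp [neckLevel]
  | succ n ih => intro x; rw [birkhoffSum_succ', ih, neckLevel_succ]; push_cast; rfl

theorem measurable_neck : Measurable fun x : NeckTree F => (x.neck 0 : ℝ) :=
  measurable_of_eq_on_cylinder fun x => ⟨0, fun y hy => by rw [hy.1 0 le_rfl]⟩

theorem measurable_log_S_neck (α : ℝ) :
    Measurable fun x : NeckTree F => Real.log (x.tree.S (x.neck 0) α) := by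
  refine measurable_of_eq_on_cylinder fun x => ⟨0, fun y hy => ?_⟩
  rw [hy.1 0 le_rfl, CodeTree.S_congr α hy.2]

variable {σlo σhi : ℝ} (hF : F.IsUniformlySimilar σlo σhi)

include hF

theorem birkhoffSum_log_S {α : ℝ} (hα : 0 ≤ α) (n : ℕ) : ∀ x : NeckTree F,
    birkhoffSum shift (fun y : NeckTree F => Real.log (y.tree.S (y.neck 0) α)) n x =
      Real.log (x.tree.S (x.neckLevel n) α) := by
  induction n with
  | zero => intro x; simp [neckLevel, CodeTree.log_S_zero hF hα]
  | succ n ih =>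
    intro x
    rw [birkhoffSum_succ', ih, neckLevel_succ, x.S_neck_add hF _ hα,
      Real.log_mul (CodeTree.S_pos hF _ hα).ne' (CodeTree.S_pos hF _ hα).ne']

variable {P : Measure (NeckTree F)} (hP : Ergodic (shift (F := F)) P)
  (hN : Integrable (fun x : NeckTree F => (x.neck 0 : ℝ)) P)

include hN in
-- Since `|log S k|` is at most a constant times `k`, integrability of `N_1` is enough.
theorem integrable_log_S_neck {α : ℝ} (hα : 0 ≤ α) :
    Integrable (fun x : NeckTree F => Real.log (x.tree.S (x.neck 0) α)) P := by
  obtain ⟨M, hM⟩ := F.m_bdd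
  refine (hN.const_mul (|α * Real.log σlo| + |Real.log M|)).mono'
    (measurable_log_S_neck α).aestronglyMeasurable (Eventually.of_forall fun x => ?_)
  exact CodeTree.abs_log_S_le hF (fun lam => hM ⟨lam, rfl⟩) hα _

variable [IsProbabilityMeasure P]

include hN in
omit hF in
theorem integral_neck_pos : 0 < ∫ x : NeckTree F, (x.neck 0 : ℝ) ∂P := by
  have h : (1 : ℝ) ≤ ∫ x : NeckTree F, (x.neck 0 : ℝ) ∂P := by
    have := integral_mono (μ := P) (integrable_const (1 : ℝ)) hN
      (fun x => Nat.one_le_cast.2 x.neck_pos)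
    simpa using this
  linarith

include hP hN in
omit hF in
theorem ae_tendsto_neckLevel_div : ∀ᵐ x ∂P, Tendsto (fun n : ℕ => (x.neckLevel n : ℝ) / n) atTop
    (𝓝 (∫ x : NeckTree F, (x.neck 0 : ℝ) ∂P)) := by
  filter_upwards [ae_tendsto_birkhoffSum_div hP measurable_neck hN] with x hx
  simpa only [birkhoffSum_neck] using hx

include hP hN in
-- The ergodic theorem is applied to `N_1` and to `log S(N_1)`. The pressure is the quotient of the
-- two means.
theorem ae_hasPressure {α : ℝ} (hα : 0 ≤ α) : ∀ᵐ x ∂P, x.tree.HasPressure α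
    ((∫ x : NeckTree F, Real.log (x.tree.S (x.neck 0) α) ∂P) /
      ∫ x : NeckTree F, (x.neck 0 : ℝ) ∂P) := by
  obtain ⟨M, hM⟩ := F.m_bdd
  filter_upwards [ae_tendsto_neckLevel_div hP hN,
    ae_tendsto_birkhoffSum_div hP (measurable_log_S_neck α) (integrable_log_S_neck hF hN hα)]
    with x h1 h2
  simp only [birkhoffSum_log_S hF hα] at h2
  exact tendsto_div_of_subsequence x.neckLevel_strictMono rfl (integral_neck_pos hN) h1
    (CodeTree.abs_log_S_succ_sub_le hF (fun lam => hM ⟨lam, rfl⟩) hα) h2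

include hP hN in
theorem exists_pressure : ∃ p : ℝ → ℝ, ∀ᵐ x ∂P, ∀ α : ℝ, 0 ≤ α →
    x.tree.HasPressure α (p α) := by
  set p : ℝ → ℝ := fun α => (∫ x : NeckTree F, Real.log (x.tree.S (x.neck 0) α) ∂P) /
      ∫ x : NeckTree F, (x.neck 0 : ℝ) ∂P with hp
  have hpr : ∀ α, 0 ≤ α → ∀ᵐ x ∂P, x.tree.HasPressure α (p α) := fun α hα =>
    ae_hasPressure hF hP hN hα
  clear_value p
  have hq : ∀ᵐ x ∂P, ∀ q : ℚ, 0 ≤ q → x.tree.HasPressure q (p q) := by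
    refine ae_all_iff.2 fun q => ?_
    by_cases h : 0 ≤ q
    · filter_upwards [hpr q (by exact_mod_cast h)] with x hx _ using hx
    · exact Eventually.of_forall fun x h' => absurd h' h
  refine ⟨p, ?_⟩
  filter_upwards [hq] with x hx α hα
  refine CodeTree.hasPressure_of_dense hF hα hx fun β hβ => ?_
  -- The Lipschitz bound concerns the deterministic function `p`, so one tree having pressure at
  -- both exponents suffices, and this tree may depend on `α` and `β`.
  obtain ⟨y, hy1, hy2⟩ := ((hpr α hα).and (hpr β (hα.trans hβ))).exists
  obtain ⟨h1, h2⟩ := hy1.sub_mem hF hα hβ hy2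
  rw [abs_of_nonpos]
  · linarith
  · refine h2.trans (mul_nonpos_of_nonneg_of_nonpos (sub_nonneg.2 hβ) ?_)
    exact (Real.log_neg hF.hi_pos hF.hi_lt_one).le

end NeckTree

end CodeTreeFractal

end

noncomputable section

namespace CodeTreeFractal

/-! ### The energy method -/

section Energy

open scoped ENNReal NNReal

/-- This is Markov's inequality: on the ball the kernel is at least `d ^ (-t)`. For radius `0` the
kernel is `⊤` there, so a finite potential leaves no mass. -/
theorem measure_closedBall_le_of_lintegral_edist {X : Type*} [PseudoEMetricSpace X]
    [MeasurableSpace X] [OpensMeasurableSpace X] {ν : Measure X} {t : ℝ} (ht : 0 < t) {x : X}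
    {M d : ℝ≥0∞} (hM : ∫⁻ y, edist x y ^ (-t) ∂ν ≤ M) (hM0 : M ≠ 0) (hMt : M ≠ ⊤) :
    ν (Metric.closedEBall x d) ≤ M * d ^ t := by
  rcases eq_or_ne d ⊤ with rfl | hd
  · rw [ENNReal.top_rpow_of_pos ht, ENNReal.mul_top hM0]
    exact le_top
  have h1 : d ^ (-t) * ν (Metric.closedEBall x d) ≤ M := by
    rw [← setLIntegral_const]
    refine le_trans ?_ ((setLIntegral_le_lintegral (Metric.closedEBall x d) _).trans hM)
    refine setLIntegral_mono' Metric.isClosed_closedEBall.measurableSet fun y hy => ?_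
    rw [Metric.mem_closedEBall, edist_comm] at hy
    rw [ENNReal.rpow_neg, ENNReal.rpow_neg]
    exact ENNReal.inv_le_inv.2 (ENNReal.rpow_le_rpow hy ht.le)
  rcases eq_or_ne d 0 with rfl | hd0
  · rw [ENNReal.zero_rpow_of_neg (neg_neg_of_pos ht)] at h1
    by_contra hne
    have : ν (Metric.closedEBall x 0) ≠ 0 := by
      intro h0
      exact hne (by rw [h0]; exact zero_le)
    rw [ENNReal.top_mul this] at h1
    exact hMt (top_le_iff.1 h1)
  · have h2 : d ^ t ≠ 0 := by simp [hd0, hd]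
    have h3 : d ^ t ≠ ⊤ := ENNReal.rpow_ne_top_of_nonneg ht.le hd
    calc ν (Metric.closedEBall x d)
        = (d ^ (-t) * ν (Metric.closedEBall x d)) * d ^ t := by
          rw [ENNReal.rpow_neg, mul_right_comm, ENNReal.inv_mul_cancel h2 h3, one_mul]
      _ ≤ M * d ^ t := by gcongr

/-- The energy method for lower bounds of the Hausdorff dimension. -/
theorem le_dimH_of_energy_ne_top {X : Type*} [MetricSpace X] [SecondCountableTopology X]
    [MeasurableSpace X] [BorelSpace X] {ν : Measure X} [SFinite ν] {t : ℝ≥0} (ht : 0 < t)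
    {s : Set X} (hs : ν s ≠ 0)
    (hE : ∫⁻ x, ∫⁻ y, edist x y ^ (-(t : ℝ)) ∂ν ∂ν ≠ ⊤) : (t : ℝ≥0∞) ≤ dimH s := by
  have ht' : (0 : ℝ) < t := ht
  set φ : X → ℝ≥0∞ := fun x => ∫⁻ y, edist x y ^ (-(t : ℝ)) ∂ν with hφ
  have hm : Measurable φ := by
    refine Measurable.lintegral_prod_right' (f := fun p : X × X => edist p.1 p.2 ^ (-(t : ℝ))) ?_
    exact measurable_edist.pow_const _
  have hfin : ν {x | φ x = ⊤} = 0 := measure_eq_top_of_lintegral_ne_top hm.aemeasurable hE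
  -- The potential `φ` is finite almost everywhere, so some sublevel set charges `s`. On it `ν` is
  -- controlled by powers of diameters, and the mass distribution principle applies.
  obtain ⟨M, hM⟩ : ∃ M : ℕ, ν (s ∩ {x | φ x ≤ M}) ≠ 0 := by
    by_contra! h
    refine hs (measure_mono_null (t := (⋃ M : ℕ, s ∩ {x | φ x ≤ M}) ∪ {x | φ x = ⊤}) ?_ ?_)
    · intro x hx
      rcases eq_or_ne (φ x) ⊤ with h' | h'
      · exact Or.inr h'
      · obtain ⟨M, hM⟩ := ENNReal.exists_nat_gt h'
        exact Or.inl (Set.mem_iUnion.2 ⟨M, hx, hM.le⟩)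
    · exact measure_union_null (measure_iUnion_null h) hfin
  have hA : MeasurableSet {x | φ x ≤ M} := measurableSet_le hm measurable_const
  set K : ℝ≥0∞ := (M : ℝ≥0∞) + 1 with hK
  have hK0 : K ≠ 0 := by simp [hK]
  have hKt : K ≠ ⊤ := by simp [hK]
  have hle : K⁻¹ • ν.restrict {x | φ x ≤ M} ≤ Measure.hausdorffMeasure (t : ℝ) := by
    refine Measure.le_hausdorffMeasure _ _ 1 one_pos fun U _ => ?_
    rw [Measure.smul_apply, smul_eq_mul, Measure.restrict_apply' hA,
      ENNReal.inv_mul_le_iff hK0 hKt]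
    rcases Set.eq_empty_or_nonempty (U ∩ {x | φ x ≤ M}) with h | ⟨x, hxU, hx⟩
    · rw [h, measure_empty]
      exact zero_le
    · refine le_trans (measure_mono ?_) (measure_closedBall_le_of_lintegral_edist ht'
        (x := x) (d := Metric.ediam U) ((show φ x ≤ M from hx).trans le_self_add) hK0 hKt)
      rintro y ⟨hy, -⟩
      exact Metric.edist_le_ediam_of_mem hy hxU
  refine le_dimH_of_hausdorffMeasure_ne_zero fun h0 => hM ?_
  have h1 := hle s
  rw [h0, Measure.smul_apply, smul_eq_mul, Measure.restrict_apply' hA, nonpos_iff_eq_zero,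
    mul_eq_zero] at h1
  exact h1.resolve_left (ENNReal.inv_ne_zero.2 hKt)

end Energy

/-! ### Riesz kernels averaged over parameters -/

section Riesz

open scoped ENNReal NNReal

variable {D : ℕ}

theorem lintegral_ball_enorm_rpow_ne_top (hD : 1 ≤ D) {t : ℝ} (ht : t < D) (r : ℝ) :
    ∫⁻ x in Metric.ball (0 : EuclideanSpace ℝ (Fin D)) r, ‖x‖ₑ ^ (-t) ≠ ⊤ := by
  have hint : IntegrableOn (fun x : EuclideanSpace ℝ (Fin D) => ‖x‖ ^ (-t)) (Metric.ball 0 r) := by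
    refine integrableOn_ball_of_norm_le_rpow (C := 1) (α := t) (by simpa using hD)
      (by simpa using ht) (Eventually.of_forall fun x => ?_) ?_
    · rw [one_mul, Real.norm_of_nonneg (Real.rpow_nonneg (norm_nonneg x) _)]
    · exact (measurable_norm.pow_const _).aestronglyMeasurable
  -- At the origin the extended power can be `⊤` while the real power is finite, so they are
  -- compared off this null set.
  have hne : ∀ᵐ x : EuclideanSpace ℝ (Fin D), x ≠ 0 := by
    have : Nontrivial (EuclideanSpace ℝ (Fin D)) :=
      Module.nontrivial_of_finrank_pos (R := ℝ) (by simpa using Nat.pos_of_ne_zero (by omega : D ≠ 0))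
    exact Measure.ae_ne volume 0
  have h := hint.2
  rw [hasFiniteIntegral_iff_enorm] at h
  refine ne_of_lt (lt_of_le_of_lt (lintegral_mono_ae ?_) h)
  filter_upwards [ae_restrict_of_ae hne] with x hx
  have hx' : 0 < ‖x‖ := norm_pos_iff.2 hx
  rw [Real.enorm_eq_ofReal (Real.rpow_nonneg hx'.le _), ← ENNReal.ofReal_rpow_of_pos hx',
    ofReal_norm]

/-- Riesz potentials of balls are bounded. -/
theorem exists_lintegral_ball_enorm_sub_rpow_le (hD : 1 ≤ D) {t : ℝ} (ht0 : 0 ≤ t) (ht : t < D)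
    (R : ℝ) : ∃ C : ℝ≥0∞, C ≠ ⊤ ∧ ∀ b : EuclideanSpace ℝ (Fin D),
      ∫⁻ x in Metric.ball (0 : EuclideanSpace ℝ (Fin D)) R, ‖x - b‖ₑ ^ (-t) ≤ C := by
  refine ⟨volume (Metric.ball (0 : EuclideanSpace ℝ (Fin D)) R) +
    ∫⁻ x in Metric.ball (0 : EuclideanSpace ℝ (Fin D)) 1, ‖x‖ₑ ^ (-t),
    ENNReal.add_ne_top.2 ⟨measure_ball_lt_top.ne, lintegral_ball_enorm_rpow_ne_top hD ht 1⟩,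
    fun b => ?_⟩
  -- The kernel is at most `1` outside the unit ball. The part inside has an integral invariant
  -- under translation, which makes the bound uniform in `b`.
  have hpt : ∀ x : EuclideanSpace ℝ (Fin D), ‖x‖ₑ ^ (-t) ≤
      1 + (Metric.ball (0 : EuclideanSpace ℝ (Fin D)) 1).indicator (fun y => ‖y‖ₑ ^ (-t)) x := by
    intro x
    by_cases hx : x ∈ Metric.ball (0 : EuclideanSpace ℝ (Fin D)) 1
    · rw [Set.indicator_of_mem hx]
      exact le_add_self
    · refine le_trans ?_ le_self_add
      rw [mem_ball_zero_iff, not_lt] at hx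
      rw [ENNReal.rpow_neg, ENNReal.inv_le_one]
      rw [← ENNReal.one_rpow t]
      refine ENNReal.rpow_le_rpow ?_ ht0
      rw [← ofReal_norm, ENNReal.one_le_ofReal]
      exact hx
  calc ∫⁻ x in Metric.ball (0 : EuclideanSpace ℝ (Fin D)) R, ‖x - b‖ₑ ^ (-t)
      ≤ ∫⁻ x in Metric.ball (0 : EuclideanSpace ℝ (Fin D)) R, (1 +
        (Metric.ball (0 : EuclideanSpace ℝ (Fin D)) 1).indicator (fun y => ‖y‖ₑ ^ (-t)) (x - b)) :=
        lintegral_mono fun x => hpt (x - b)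
    _ = volume (Metric.ball (0 : EuclideanSpace ℝ (Fin D)) R) +
        ∫⁻ x in Metric.ball (0 : EuclideanSpace ℝ (Fin D)) R,
          (Metric.ball (0 : EuclideanSpace ℝ (Fin D)) 1).indicator (fun y => ‖y‖ₑ ^ (-t))
            (x - b) := by
        rw [lintegral_add_left measurable_const]
        simp
    _ ≤ _ := by
        refine add_le_add le_rfl ?_
        refine (setLIntegral_le_lintegral (Metric.ball 0 R) _).trans ?_
        rw [lintegral_sub_right_eq_self (fun x =>
          (Metric.ball (0 : EuclideanSpace ℝ (Fin D)) 1).indicator (fun y => ‖y‖ₑ ^ (-t)) x) b,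
          lintegral_indicator measurableSet_ball]

/-- Tonelli, integrating coordinate `u` first. The comparison function is the constant `C / ν univ`,
whose integral over that coordinate is `C`. -/
theorem lintegral_pi_le_of_forall_update {ι X : Type*} [Fintype ι] [DecidableEq ι]
    [MeasurableSpace X]
    {ν : Measure X} [IsFiniteMeasure ν] (hν : ν Set.univ ≠ 0) {f : (ι → X) → ℝ≥0∞}
    (hf : Measurable f) (u : ι) {C : ℝ≥0∞}
    (h : ∀ x, ∫⁻ y, f (Function.update x u y) ∂ν ≤ C) :
    ∫⁻ x, f x ∂Measure.pi (fun _ => ν) ≤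
      C / ν Set.univ * Measure.pi (fun _ : ι => ν) Set.univ := by
  rw [← lintegral_const]
  refine lintegral_le_of_lmarginal_le {u} hf measurable_const fun x => ?_
  rw [lmarginal_singleton, lmarginal_singleton]
  simp only [lintegral_const]
  rw [ENNReal.div_mul_cancel hν (measure_ne_top _ _)]
  exact h x

/-- Averages of Riesz kernels along a linear map that expands along one coordinate space. -/
theorem exists_lintegral_enorm_linearMap_rpow_le (hD : 1 ≤ D) {t : ℝ} (ht0 : 0 ≤ t) (ht : t < D)
    {R : ℝ} (hR : 0 < R) (ι : Type*) [Fintype ι] [DecidableEq ι] : ∃ C : ℝ≥0∞, C ≠ ⊤ ∧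
      ∀ (L : (ι → EuclideanSpace ℝ (Fin D)) →ₗ[ℝ] EuclideanSpace ℝ (Fin D)) (κ : ℝ), 0 < κ →
        (∃ u, ∀ h, κ * ‖h‖ ≤ ‖L (Pi.single u h)‖) →
        ∫⁻ a in Set.univ.pi fun _ => Metric.ball 0 R, ‖L a‖ₑ ^ (-t) ≤
          C * ENNReal.ofReal κ ^ (-t) := by
  obtain ⟨C, hC, hCb⟩ := exists_lintegral_ball_enorm_sub_rpow_le hD ht0 ht R
  set ν : Measure (EuclideanSpace ℝ (Fin D)) := volume.restrict (Metric.ball 0 R) with hν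
  have hfin : IsFiniteMeasure ν := ⟨by
    rw [hν, Measure.restrict_apply_univ]; exact measure_ball_lt_top⟩
  have hν0 : ν Set.univ ≠ 0 := by
    rw [hν, Measure.restrict_apply_univ]
    exact (Metric.measure_ball_pos _ _ hR).ne'
  refine ⟨C / ν Set.univ * Measure.pi (fun _ : ι => ν) Set.univ,
    ENNReal.mul_ne_top (ENNReal.div_ne_top hC hν0) (measure_ne_top _ _), fun L κ hκ hL => ?_⟩
  obtain ⟨u, hu⟩ := hL
  have hLc : Continuous L := L.continuous_of_finiteDimensional
  have key := lintegral_pi_le_of_forall_update (ν := ν) hν0 (f := fun a => ‖L a‖ₑ ^ (-t))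
    (hLc.measurable.enorm.pow_const _) u (C := C * ENNReal.ofReal κ ^ (-t)) (fun x => ?_)
  · rw [volume_pi, Measure.restrict_pi_pi]
    refine key.trans (le_of_eq ?_)
    simp only [div_eq_mul_inv]
    ring
  · set G : EuclideanSpace ℝ (Fin D) →ₗ[ℝ] EuclideanSpace ℝ (Fin D) :=
      L ∘ₗ LinearMap.single ℝ (fun _ => EuclideanSpace ℝ (Fin D)) u with hG
    have hGn : ∀ h, κ * ‖h‖ ≤ ‖G h‖ := fun h => hu h
    have hGinj : Function.Injective G := by
      refine (injective_iff_map_eq_zero G).2 fun h h0 => ?_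
      have := hGn h
      rw [h0, norm_zero] at this
      exact norm_le_zero_iff.1 (nonpos_of_mul_nonpos_right this hκ)
    -- The restriction `G` of `L` to coordinate `u` is an injective endomorphism, hence onto. The
    -- contribution of the other coordinates is therefore absorbed into a shift `b`, and the Riesz
    -- bound is uniform in `b`.
    obtain ⟨b, hb⟩ := LinearMap.injective_iff_surjective.1 hGinj (-L (Function.update x u 0))
    have hupd : ∀ y, L (Function.update x u y) = G (y - b) := by
      intro y
      rw [map_sub, hb, sub_neg_eq_add]
      have : Function.update x u y = Pi.single u y + Function.update x u 0 := by
        funext q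
        by_cases hq : q = u
        · subst hq; simp
        · simp [hq]
      rw [this, map_add]
      rfl
    have hpt : ∀ y, ‖L (Function.update x u y)‖ₑ ^ (-t) ≤
        ENNReal.ofReal κ ^ (-t) * ‖y - b‖ₑ ^ (-t) := by
      intro y
      rw [hupd, ENNReal.rpow_neg, ENNReal.rpow_neg, ENNReal.rpow_neg, ← ENNReal.mul_inv,
        ← ENNReal.mul_rpow_of_nonneg _ _ ht0]
      · refine ENNReal.inv_le_inv.2 (ENNReal.rpow_le_rpow ?_ ht0)
        rw [← ofReal_norm, ← ofReal_norm, ← ENNReal.ofReal_mul hκ.le]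
        exact ENNReal.ofReal_le_ofReal (hGn _)
      · left; simp [hκ]
      · left
        exact ENNReal.rpow_ne_top_of_nonneg ht0 ENNReal.ofReal_ne_top
    calc ∫⁻ y, ‖L (Function.update x u y)‖ₑ ^ (-t) ∂ν
        ≤ ∫⁻ y, ENNReal.ofReal κ ^ (-t) * ‖y - b‖ₑ ^ (-t) ∂ν := lintegral_mono hpt
      _ = ENNReal.ofReal κ ^ (-t) * ∫⁻ y, ‖y - b‖ₑ ^ (-t) ∂ν :=
        lintegral_const_mul _ ((measurable_id.sub_const b).enorm.pow_const _)
      _ ≤ C * ENNReal.ofReal κ ^ (-t) := by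
        rw [mul_comm]
        gcongr
        exact hCb b

end Riesz

end CodeTreeFractal

end

/-! ### Limit points as linear functions of the translations; transversality -/

noncomputable section

namespace CodeTreeFractal

namespace CodeTree

theorem length_initWord (i : ℕ → ℕ) (k : ℕ) : (initWord i k).length = k := by
  simp [initWord]

theorem initWord_zero (i : ℕ → ℕ) : initWord i 0 = [] := rfl

theorem initWord_succ (i : ℕ → ℕ) (k : ℕ) : initWord i (k + 1) = initWord i k ++ [i k] := by
  simp [initWord, List.range_succ]

theorem initWord_add (i : ℕ → ℕ) (m k : ℕ) :
    initWord i (m + k) = initWord i m ++ initWord (fun n => i (m + n)) k := by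
  induction k with
  | zero => simp [initWord_zero]
  | succ k ih => rw [← add_assoc, initWord_succ, ih, initWord_succ, List.append_assoc]

theorem initWord_eq_iff {i j : ℕ → ℕ} {k : ℕ} :
    initWord i k = initWord j k ↔ ∀ n < k, i n = j n := by
  simp [initWord]

end CodeTree

namespace AffineFamily

open CodeTree

variable {D : ℕ} {Λ : Type*} (F : AffineFamily D Λ)

/-- The equivalence class of the letter `l` of the system with label `o`. -/
def cls (o : Option Λ) (l : ℕ) : Option (Quotient F.rel) :=
  match o with
  | some lam => if h : l < F.m lam then some (Quotient.mk F.rel ⟨lam, ⟨l, h⟩⟩) else none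
  | none => none

/-- The limit point with code `i` for the labelling `g` of words and the translation
parameters `a`. -/
def point (a : F.Param) (g : List ℕ → Option Λ) (i : ℕ → ℕ) : EuclideanSpace ℝ (Fin D) :=
  ∑' k, F.linWord g (initWord i k) (F.trans a (g (initWord i k)) (i k))

variable {F}

theorem trans_eq (a : F.Param) (o : Option Λ) (l : ℕ) :
    F.trans a o l = (F.cls o l).elim 0 a := by
  rcases o with _ | lam
  · rfl
  · by_cases h : l < F.m lam <;> simp [trans, cls, h]

theorem cls_ne_none {o : Option Λ} {l : ℕ} (h : l < F.deg o) : ∃ u, F.cls o l = some u := by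
  rcases o with _ | lam
  · simp [deg] at h
  · simp only [deg, Option.elim] at h
    simp [cls, h]

/-- Here `rel_inj` enters: codes that branch at a word do so into different classes, as
transversality requires. -/
theorem cls_injective {o : Option Λ} {l l' : ℕ} {u : Quotient F.rel} (h : F.cls o l = some u)
    (h' : F.cls o l' = some u) : l = l' := by
  rcases o with _ | lam
  · simp [cls] at h
  · simp only [cls, Option.dite_none_right_eq_some, Option.some.injEq] at h h'
    obtain ⟨h1, h2⟩ := h
    obtain ⟨h3, h4⟩ := h'
    have := F.rel_inj lam _ _ (Quotient.exact (h2.trans h4.symm))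
    simpa using this

theorem trans_add (a b : F.Param) (o : Option Λ) (l : ℕ) :
    F.trans (a + b) o l = F.trans a o l + F.trans b o l := by
  simp only [trans_eq]
  cases F.cls o l <;> simp

theorem trans_smul (c : ℝ) (a : F.Param) (o : Option Λ) (l : ℕ) :
    F.trans (c • a) o l = c • F.trans a o l := by
  simp only [trans_eq]
  cases F.cls o l <;> simp

theorem norm_trans_le [Fintype (Quotient F.rel)] (a : F.Param) (o : Option Λ) (l : ℕ) :
    ‖F.trans a o l‖ ≤ ‖a‖ := by
  rw [trans_eq]
  cases F.cls o l with
  | none => simp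
  | some u => exact norm_le_pi_norm a u

theorem mapWord_initWord (a : F.Param) (g : List ℕ → Option Λ) (i : ℕ → ℕ) (k : ℕ) :
    F.mapWord a g (initWord i k) 0 = ∑ n ∈ Finset.range k,
      F.linWord g (initWord i n) (F.trans a (g (initWord i n)) (i n)) := by
  induction k with
  | zero => rfl
  | succ k ih => rw [initWord_succ, mapWord_concat_zero, ih, Finset.sum_range_succ]

variable [Fintype (Quotient F.rel)] {σlo σhi : ℝ} (hF : F.IsUniformlySimilar σlo σhi)

include hF

theorem norm_term_le (a : F.Param) (g : List ℕ → Option Λ) (i : ℕ → ℕ) (k : ℕ) :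
    ‖F.linWord g (initWord i k) (F.trans a (g (initWord i k)) (i k))‖ ≤ ‖a‖ * σhi ^ k := by
  rw [hF.norm_linWord, mul_comm]
  have h := hF.ratioWord_le (initWord i k) g
  rw [length_initWord] at h
  exact mul_le_mul (norm_trans_le _ _ _) h (F.ratioWord_nonneg _ _) (norm_nonneg _)

theorem summable_term (a : F.Param) (g : List ℕ → Option Λ) (i : ℕ → ℕ) :
    Summable fun k => F.linWord g (initWord i k) (F.trans a (g (initWord i k)) (i k)) :=
  Summable.of_norm_bounded
    ((summable_geometric_of_lt_one hF.hi_pos.le hF.hi_lt_one).mul_left ‖a‖)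
    (norm_term_le hF a g i)

theorem tendsto_mapWord_point (a : F.Param) (g : List ℕ → Option Λ) (i : ℕ → ℕ) :
    Tendsto (fun k => F.mapWord a g (initWord i k) 0) atTop (𝓝 (F.point a g i)) := by
  simp only [mapWord_initWord]
  exact (summable_term hF a g i).hasSum.tendsto_sum_nat

theorem norm_point_le (a : F.Param) (g : List ℕ → Option Λ) (i : ℕ → ℕ) :
    ‖F.point a g i‖ ≤ ‖a‖ * (1 - σhi)⁻¹ :=
  tsum_of_norm_bounded ((hasSum_geometric_of_lt_one hF.hi_pos.le hF.hi_lt_one).mul_left ‖a‖)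
    (norm_term_le hF a g i)

theorem point_eq (a : F.Param) (g : List ℕ → Option Λ) (i : ℕ → ℕ) (m : ℕ) :
    F.point a g i = F.linWord g (initWord i m)
        (F.point a (fun v => g (initWord i m ++ v)) fun n => i (m + n)) +
      F.mapWord a g (initWord i m) 0 := by
  have h1 := (tendsto_mapWord_point hF a g i).comp (tendsto_add_atTop_nat m)
  have h2 := (((F.linWord g (initWord i m)).continuous_of_finiteDimensional.tendsto _).comp
    (tendsto_mapWord_point hF a (fun v => g (initWord i m ++ v)) fun n => i (m + n))).add_const
    (F.mapWord a g (initWord i m) 0)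
  refine tendsto_nhds_unique h1 (h2.congr fun k => ?_)
  rw [Function.comp_apply, Function.comp_apply, add_comm k m, initWord_add, mapWord_append,
    ← mapWord_eq]

/-- The limit point as a linear function of the translation parameters. -/
def pointLinear (g : List ℕ → Option Λ) (i : ℕ → ℕ) :
    F.Param →ₗ[ℝ] EuclideanSpace ℝ (Fin D) where
  toFun a := F.point a g i
  map_add' a b := by
    simp only [point]
    rw [← (summable_term hF a g i).tsum_add (summable_term hF b g i)]
    simp only [trans_add, map_add]
  map_smul' c a := by
    simp only [point, RingHom.id_apply]
    rw [← (summable_term hF a g i).tsum_const_smul]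
    simp only [trans_smul, map_smul]

/-- `A u` is the sum of `σhi ^ k` over the positions `k ≥ 1` at which the code uses class `u`. A
position uses at most one class, so two distinct classes share a single geometric series. -/
theorem exists_forall_norm_single_sub_le [DecidableEq (Quotient F.rel)] (g : List ℕ → Option Λ)
    (i : ℕ → ℕ) : ∃ A : Quotient F.rel → ℝ,
      (∀ u v, u ≠ v → A u + A v ≤ σhi / (1 - σhi)) ∧
      ∀ u h, ‖F.point (Pi.single u h) g i - (if F.cls (g []) (i 0) = some u then h else 0)‖ ≤
        A u * ‖h‖ := by
  have hgeom : HasSum (fun k => σhi ^ (k + 1)) (σhi / (1 - σhi)) := by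
    have := (hasSum_geometric_of_lt_one hF.hi_pos.le hF.hi_lt_one).mul_left σhi
    simpa only [pow_succ', div_eq_mul_inv] using this
  have hpos : ∀ k, 0 ≤ σhi ^ (k + 1) := fun k => pow_nonneg hF.hi_pos.le _
  set c : Quotient F.rel → ℕ → ℝ := fun u k =>
    if F.cls (g (initWord i (k + 1))) (i (k + 1)) = some u then σhi ^ (k + 1) else 0 with hc
  have hcs : ∀ u, Summable (c u) := fun u => by
    refine Summable.of_nonneg_of_le (fun k => ?_) (fun k => ?_) hgeom.summable
    · simp only [hc]; split_ifs; exacts [hpos k, le_rfl]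
    · simp only [hc]; split_ifs; exacts [le_rfl, hpos k]
  refine ⟨fun u => ∑' k, c u k, fun u v huv => ?_, fun u h => ?_⟩
  · rw [← (hcs u).tsum_add (hcs v), ← hgeom.tsum_eq]
    refine ((hcs u).add (hcs v)).tsum_le_tsum (fun k => ?_) hgeom.summable
    simp only [hc]
    split_ifs with h1 h2 h2
    · exact absurd (Option.some.inj (h1.symm.trans h2)) huv
    · simp
    · simp
    · simpa using hpos k
  · have hfirst : F.trans (Pi.single u h) (g []) (i 0) =
        if F.cls (g []) (i 0) = some u then h else 0 := by
      rw [trans_eq]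
      rcases F.cls (g []) (i 0) with _ | v
      · simp
      · by_cases huv : v = u
        · subst huv; simp
        · simp [huv]
    have hsum := summable_term hF (Pi.single u h) g i
    rw [point, hsum.tsum_eq_zero_add, initWord_zero, hfirst, linWord, LinearMap.id_apply,
      add_sub_cancel_left]
    refine tsum_of_norm_bounded ((hcs u).hasSum.mul_right ‖h‖) fun k => ?_
    have hr := hF.ratioWord_le (initWord i (k + 1)) g
    rw [length_initWord] at hr
    rw [hF.norm_linWord, trans_eq]
    simp only [hc]
    rcases F.cls (g (initWord i (k + 1))) (i (k + 1)) with _ | v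
    · simp
    · by_cases huv : v = u
      · subst huv
        simpa using mul_le_mul_of_nonneg_right hr (norm_nonneg h)
      · simp [huv]

/-- Transversality: if the first letters of two codes belong to different classes, then the
difference of the limit points expands in the translation vector of one of the two classes. -/
theorem exists_expanding_coordinate [DecidableEq (Quotient F.rel)] {g : List ℕ → Option Λ}
    {i j : ℕ → ℕ} {u v : Quotient F.rel} (hi : F.cls (g []) (i 0) = some u)
    (hj : F.cls (g []) (j 0) = some v) (huv : u ≠ v) : ∃ w, ∀ h,
      (1 - σhi / (1 - σhi)) * ‖h‖ ≤ ‖F.point (Pi.single w h) g i - F.point (Pi.single w h) g j‖ := by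
  obtain ⟨A, hA, hA'⟩ := exists_forall_norm_single_sub_le hF g i
  obtain ⟨B, hB, hB'⟩ := exists_forall_norm_single_sub_le hF g j
  -- The four errors add up to at most `2 σhi / (1 - σhi)`, so one of the classes carries at most
  -- half. This half is below `1` exactly when `σhi < 1/2`; adding separate bounds for the two codes
  -- would require `σhi < 1/3`.
  have key : A u + B u ≤ σhi / (1 - σhi) ∨ A v + B v ≤ σhi / (1 - σhi) := by
    by_contra! hcon
    linarith [hA u v huv, hB u v huv]
  rcases key with hk | hk
  · refine ⟨u, fun h => ?_⟩
    have h1 := hA' u h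
    have h2 := hB' u h
    rw [hi, if_pos rfl] at h1
    rw [hj, if_neg (by simpa using huv.symm), sub_zero] at h2
    set x := F.point (Pi.single u h) g i
    set y := F.point (Pi.single u h) g j
    have h3 : ‖h‖ ≤ ‖x - y‖ + ‖x - h‖ + ‖y‖ := by
      have e : h = (x - y) - (x - h) + y := by abel
      calc ‖h‖ = ‖(x - y) - (x - h) + y‖ := by rw [← e]
        _ ≤ _ := (norm_add_le _ _).trans (by gcongr; exact norm_sub_le _ _)
    nlinarith [mul_le_mul_of_nonneg_right hk (norm_nonneg h)]
  · refine ⟨v, fun h => ?_⟩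
    have h1 := hA' v h
    have h2 := hB' v h
    rw [hj, if_pos rfl] at h2
    rw [hi, if_neg (by simpa using huv), sub_zero] at h1
    set x := F.point (Pi.single v h) g i
    set y := F.point (Pi.single v h) g j
    have h3 : ‖h‖ ≤ ‖x - y‖ + ‖x‖ + ‖y - h‖ := by
      have e : h = x - (x - y) - (y - h) := by abel
      calc ‖h‖ = ‖x - (x - y) - (y - h)‖ := by rw [← e]
        _ ≤ _ := (norm_sub_le _ _).trans (by gcongr; rw [add_comm]; exact norm_sub_le _ _)
    nlinarith [mul_le_mul_of_nonneg_right hk (norm_nonneg h)]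

end AffineFamily

/-! ### Upper bound of the dimension -/

namespace CodeTree

open AffineFamily

open scoped ENNReal NNReal

variable {D : ℕ} {Λ : Type*} {F : AffineFamily D Λ} {ω : CodeTree F}
  {σlo σhi : ℝ} (hF : F.IsUniformlySimilar σlo σhi)

include hF

theorem HasPressure.tendsto_S_zero {α q : ℝ} (hα : 0 ≤ α) (hq : ω.HasPressure α q)
    (hneg : q < 0) : Tendsto (fun k => ω.S k α) atTop (𝓝 0) := by
  have h1 : Tendsto (fun k : ℕ => Real.log (ω.S k α) / k * k) atTop atBot :=
    Tendsto.neg_mul_atTop hneg hq tendsto_natCast_atTop_atTop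
  refine (Real.tendsto_exp_atBot.comp h1).congr' ?_
  filter_upwards [eventually_gt_atTop 0] with k hk
  have : (k : ℝ) ≠ 0 := by positivity
  rw [Function.comp_apply, div_mul_cancel₀ _ this, Real.exp_log (S_pos hF k hα)]

variable [Fintype (Quotient F.rel)]

theorem mem_attractor_iff {a : F.Param} {x : EuclideanSpace ℝ (Fin D)} :
    x ∈ ω.attractor a ↔ ∃ i ∈ ω.paths, F.point a ω.label i = x := by
  refine exists_congr fun i => and_congr_right fun _ => ?_
  exact ⟨fun h => tendsto_nhds_unique (tendsto_mapWord_point hF a ω.label i) h,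
    fun h => h ▸ tendsto_mapWord_point hF a ω.label i⟩

/-- The upper bound of the dimension by the natural covers. -/
theorem dimH_attractor_le (a : F.Param) {α q : ℝ} (hα : 0 ≤ α) (hq : ω.HasPressure α q)
    (hneg : q < 0) : dimH (ω.attractor a) ≤ ENNReal.ofReal α := by
  -- Every limit point has norm at most `R`. The points whose code starts with `τ` therefore lie in
  -- the ball of radius `ratioWord τ * R` about the image of `0`.
  set R : ℝ := ‖a‖ * (1 - σhi)⁻¹ with hR
  have hR0 : 0 ≤ R := mul_nonneg (norm_nonneg _) (inv_nonneg.2 (by linarith [hF.hi_lt_one]))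
  have hsum : Tendsto (fun k => ENNReal.ofReal ((2 * R) ^ α * ω.S k α)) atTop (𝓝 0) := by
    have h := (hq.tendsto_S_zero hF hα hneg).const_mul ((2 * R) ^ α)
    rw [mul_zero] at h
    simpa using ENNReal.tendsto_ofReal h
  set t : ∀ k : ℕ, ω.level k → Set (EuclideanSpace ℝ (Fin D)) := fun k τ =>
    Metric.closedBall (F.mapWord a ω.label τ 0) (F.ratioWord ω.label τ * R) with ht
  have hdiam : ∀ k (τ : ω.level k), Metric.ediam (t k τ) ≤
      ENNReal.ofReal (F.ratioWord ω.label τ * (2 * R)) := by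
    intro k τ
    rw [show F.ratioWord ω.label τ * (2 * R) = 2 * (F.ratioWord ω.label τ * R) by ring,
      ENNReal.ofReal_mul zero_le_two, ENNReal.ofReal_ofNat]
    have h0 : 0 ≤ F.ratioWord ω.label τ * R := mul_nonneg (F.ratioWord_nonneg _ _) hR0
    show Metric.ediam (Metric.closedBall _ _) ≤ _
    rw [← Metric.closedEBall_ofReal h0]
    exact Metric.ediam_closedEBall_le
  have hle := Measure.hausdorffMeasure_le_liminf_sum α (ω.attractor a) (l := atTop)
    (fun k : ℕ => ENNReal.ofReal (σhi ^ k * (2 * R))) (by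
      have h := (tendsto_pow_atTop_nhds_zero_of_lt_one hF.hi_pos.le hF.hi_lt_one).mul_const (2 * R)
      rw [zero_mul] at h
      simpa using ENNReal.tendsto_ofReal h) t (Eventually.of_forall fun k τ => by
      refine (hdiam k τ).trans (ENNReal.ofReal_le_ofReal ?_)
      have h := hF.ratioWord_le τ.1 ω.label
      rw [(mem_level.1 τ.2).2] at h
      gcongr) (Eventually.of_forall fun k x hx => by
      obtain ⟨i, hi, rfl⟩ := (mem_attractor_iff hF).1 hx
      refine Set.mem_iUnion.2 ⟨⟨initWord i k, mem_level.2 ⟨hi k, length_initWord i k⟩⟩, ?_⟩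
      rw [ht, Metric.mem_closedBall, dist_eq_norm, point_eq hF a ω.label i k, add_sub_cancel_right,
        hF.norm_linWord]
      exact mul_le_mul_of_nonneg_left (norm_point_le hF _ _ _) (F.ratioWord_nonneg _ _))
  have hbd : ∀ k, ∑ τ, Metric.ediam (t k τ) ^ α ≤ ENNReal.ofReal ((2 * R) ^ α * ω.S k α) := by
    intro k
    rw [S_eq hF k hα, Finset.mul_sum, ENNReal.ofReal_sum_of_nonneg fun τ _ =>
      mul_nonneg (Real.rpow_nonneg (by positivity) _)
        (Real.rpow_nonneg (F.ratioWord_nonneg _ _) _),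
      ← Finset.sum_coe_sort (ω.level k) fun τ =>
        ENNReal.ofReal ((2 * R) ^ α * F.ratioWord ω.label τ ^ α)]
    refine Finset.sum_le_sum fun τ _ => ?_
    rw [← Real.mul_rpow (by positivity) (F.ratioWord_nonneg _ _), mul_comm (2 * R),
      ← ENNReal.ofReal_rpow_of_nonneg (mul_nonneg (F.ratioWord_nonneg _ _) (by positivity)) hα]
    exact ENNReal.rpow_le_rpow (hdiam k τ) hα
  have hzero : Measure.hausdorffMeasure α (ω.attractor a) = 0 := by
    refine le_antisymm (hle.trans ?_) zero_le
    refine (liminf_le_liminf (Eventually.of_forall hbd)).trans ?_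
    rw [hsum.liminf_eq]
  lift α to ℝ≥0 using hα
  rw [ENNReal.ofReal_coe_nnreal]
  exact dimH_le_of_hausdorffMeasure_ne_top (by rw [hzero]; exact ENNReal.zero_ne_top)

end CodeTree

end CodeTreeFractal

end

/-! ### The natural measure on paths -/

noncomputable section

namespace CodeTreeFractal

instance : MeasurableSpace (List ℕ) := ⊤

instance : DiscreteMeasurableSpace (List ℕ) := ⟨fun _ => trivial⟩

section Concatenation

/-- The concatenation of the first `n` terms of a sequence of words. -/
def concatWord (y : ℕ → List ℕ) (n : ℕ) : List ℕ := ((List.range n).map y).flatten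

/-- The infinite concatenation of a sequence of nonempty words. -/
def concatPath (y : ℕ → List ℕ) (k : ℕ) : ℕ := (concatWord y (k + 1)).getD k 0

variable {y z : ℕ → List ℕ}

theorem concatWord_zero : concatWord y 0 = [] := rfl

theorem concatWord_succ (n : ℕ) : concatWord y (n + 1) = concatWord y n ++ y n := by
  simp [concatWord, List.range_succ]

theorem concatWord_succ' (n : ℕ) :
    concatWord y (n + 1) = y 0 ++ concatWord (fun m => y (m + 1)) n := by
  simp [concatWord, List.range_succ_eq_map, Function.comp_def]

theorem concatWord_prefix {m n : ℕ} (h : m ≤ n) : concatWord y m <+: concatWord y n := by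
  induction n, h using Nat.le_induction with
  | base => exact List.prefix_rfl
  | succ n _ ih => exact ih.trans (concatWord_succ n ▸ List.prefix_append _ _)

theorem eq_of_concatWord_eq (hl : ∀ m, (y m).length = (z m).length) {n : ℕ}
    (h : concatWord y n = concatWord z n) : ∀ m < n, y m = z m := by
  induction n with
  | zero => intro m hm; omega
  | succ n ih =>
    rw [concatWord_succ, concatWord_succ] at h
    obtain ⟨h1, h2⟩ := List.append_inj' h (hl n)
    intro m hm
    rcases Nat.lt_succ_iff_lt_or_eq.1 hm with hm | rfl
    · exact ih h1 m hm
    · exact h2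

theorem getD_eq_of_prefix {l l' : List ℕ} (h : l <+: l') {k : ℕ} (hk : k < l.length) :
    l'.getD k 0 = l.getD k 0 := by
  obtain ⟨r, rfl⟩ := h
  exact List.getD_append _ _ _ _ hk

/-- By `hlen` the first `k + 1` words already reach position `k`, so the default letter in
`concatPath` is never read. Later words only extend the prefix. -/
theorem initWord_concatPath (hlen : ∀ n, n ≤ (concatWord y n).length) (n : ℕ) :
    CodeTree.initWord (concatPath y) (concatWord y n).length = concatWord y n := by
  refine List.ext_getElem (by simp [CodeTree.length_initWord]) fun k h1 h2 => ?_
  have h3 : k < (concatWord y (k + 1)).length := hlen (k + 1)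
  have h4 : concatPath y k = (concatWord y n).getD k 0 := by
    rcases le_total (k + 1) n with h | h
    · exact (getD_eq_of_prefix (concatWord_prefix h) h3).symm
    · exact getD_eq_of_prefix (concatWord_prefix h) h2
  simp [CodeTree.initWord, h4, h2]

theorem measurable_concatWord (n : ℕ) : Measurable fun y : ℕ → List ℕ => concatWord y n := by
  induction n with
  | zero => exact measurable_const
  | succ n ih =>
    simp only [concatWord_succ]
    exact (measurable_of_countable fun p : List ℕ × List ℕ => p.1 ++ p.2).comp
      (ih.prodMk (measurable_pi_apply n))

theorem measurable_concatPath : Measurable concatPath :=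
  measurable_pi_lambda _ fun k => (measurable_of_countable fun w : List ℕ => w.getD k 0).comp
    (measurable_concatWord (k + 1))

theorem measurable_initWord (k : ℕ) : Measurable fun i : ℕ → ℕ => CodeTree.initWord i k := by
  induction k with
  | zero => exact measurable_const
  | succ k ih =>
    simp only [CodeTree.initWord_succ]
    exact (measurable_of_countable fun p : List ℕ × ℕ => p.1 ++ [p.2]).comp
      (ih.prodMk (measurable_pi_apply k))

end Concatenation

namespace NeckTree

variable {D : ℕ} {Λ : Type*} {F : AffineFamily D Λ}

theorem concatWord_mem_level (n : ℕ) : ∀ {x : NeckTree F} {y : ℕ → List ℕ},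
    (∀ m, y m ∈ (shift^[m] x).tree.level ((shift^[m] x).neck 0)) →
    concatWord y n ∈ x.tree.level (x.neckLevel n) := by
  induction n with
  | zero => intro x y _; simp [concatWord_zero, neckLevel, CodeTree.level_zero]
  | succ n ih =>
    intro x y h
    have h1 := CodeTree.mem_level.1 (ih (x := x.shift) fun m => h (m + 1))
    rw [concatWord_succ', neckLevel_succ, CodeTree.mem_level]
    exact ⟨(x.append_mem_words (h 0) _).2 h1.1, by
      rw [List.length_append, h1.2, (CodeTree.mem_level.1 (h 0)).2]; rfl⟩

theorem ratioWord_concatWord (n : ℕ) : ∀ {x : NeckTree F} {y : ℕ → List ℕ},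
    (∀ m, y m ∈ (shift^[m] x).tree.level ((shift^[m] x).neck 0)) →
    F.ratioWord x.tree.label (concatWord y n) =
      ∏ m ∈ Finset.range n, F.ratioWord (shift^[m] x).tree.label (y m) := by
  induction n with
  | zero => intro x y _; rfl
  | succ n ih =>
    intro x y h
    rw [concatWord_succ', x.ratioWord_append (h 0), ih (x := x.shift) fun m => h (m + 1),
      Finset.prod_range_succ', mul_comm]
    rfl

variable {σlo σhi : ℝ} (hF : F.IsUniformlySimilar σlo σhi)

include hF

theorem S_neckLevel {t : ℝ} (ht : 0 ≤ t) (n : ℕ) : ∀ x : NeckTree F,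
    x.tree.S (x.neckLevel n) t =
      ∏ m ∈ Finset.range n, (shift^[m] x).tree.S ((shift^[m] x).neck 0) t := by
  induction n with
  | zero => intro x; simp [neckLevel, CodeTree.S_zero hF ht]
  | succ n ih =>
    intro x
    rw [neckLevel_succ, x.S_neck_add hF _ ht, ih, Finset.prod_range_succ', mul_comm]
    rfl

omit hF

/-- The probability measure on the words below the first neck which gives to a word a mass
proportional to the `t`-th power of its ratio. -/
def blockMeasure (x : NeckTree F) (t : ℝ) : Measure (List ℕ) :=
  ∑ w ∈ x.tree.level (x.neck 0),
    ENNReal.ofReal (F.ratioWord x.tree.label w ^ t / x.tree.S (x.neck 0) t) • Measure.dirac w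

theorem blockMeasure_apply (x : NeckTree F) (t : ℝ) (s : Set (List ℕ)) :
    x.blockMeasure t s = ∑ w ∈ x.tree.level (x.neck 0),
      ENNReal.ofReal (F.ratioWord x.tree.label w ^ t / x.tree.S (x.neck 0) t) *
        s.indicator 1 w := by
  simp [blockMeasure, Measure.finsetSum_apply]

theorem blockMeasure_singleton {x : NeckTree F} {t : ℝ} {w : List ℕ}
    (hw : w ∈ x.tree.level (x.neck 0)) : x.blockMeasure t {w} =
      ENNReal.ofReal (F.ratioWord x.tree.label w ^ t / x.tree.S (x.neck 0) t) := by
  rw [blockMeasure_apply, Finset.sum_eq_single w]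
  · simp
  · intro v _ hv
    simp [hv]
  · exact fun h => absurd hw h

theorem ae_blockMeasure (x : NeckTree F) (t : ℝ) :
    ∀ᵐ w ∂x.blockMeasure t, w ∈ x.tree.level (x.neck 0) := by
  rw [ae_iff, blockMeasure_apply]
  refine Finset.sum_eq_zero fun w hw => ?_
  simp [hw]

include hF

theorem isProbabilityMeasure_blockMeasure (x : NeckTree F) {t : ℝ} (ht : 0 ≤ t) :
    IsProbabilityMeasure (x.blockMeasure t) := by
  refine ⟨?_⟩
  have h0 := CodeTree.S_pos (ω := x.tree) hF (x.neck 0) ht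
  rw [blockMeasure_apply]
  simp only [Set.indicator_univ, Pi.one_apply, mul_one]
  rw [← ENNReal.ofReal_sum_of_nonneg fun w _ =>
    div_nonneg (Real.rpow_nonneg (F.ratioWord_nonneg _ _) _) h0.le, ← Finset.sum_div,
    ← CodeTree.S_eq hF _ ht, div_self h0.ne', ENNReal.ofReal_one]

/-- The natural measure of exponent `t` on the infinite paths. -/
theorem exists_path_measure (x : NeckTree F) {t : ℝ} (ht : 0 ≤ t) :
    ∃ μ : Measure (ℕ → ℕ), IsProbabilityMeasure μ ∧ (∀ᵐ i ∂μ, i ∈ x.tree.paths) ∧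
      ∀ n, ∀ τ : List ℕ, μ {i | CodeTree.initWord i (x.neckLevel n) = τ} ≤
        ENNReal.ofReal (F.ratioWord x.tree.label τ ^ t / x.tree.S (x.neckLevel n) t) := by
  have hprob : ∀ m, IsProbabilityMeasure ((shift^[m] x).blockMeasure t) := fun m =>
    isProbabilityMeasure_blockMeasure hF _ ht
  -- Blocks can be chosen independently because what may follow a neck does not depend on the
  -- prefix.
  set ρ : Measure (ℕ → List ℕ) := Measure.infinitePi fun m => (shift^[m] x).blockMeasure t with hρ
  have hgood : ∀ᵐ y ∂ρ, ∀ m, y m ∈ (shift^[m] x).tree.level ((shift^[m] x).neck 0) :=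
    ae_all_iff.2 fun m => (measurePreserving_eval_infinitePi _ m).quasiMeasurePreserving.ae
      (ae_blockMeasure (shift^[m] x) t)
  have hlen : ∀ y : ℕ → List ℕ, (∀ m, y m ∈ (shift^[m] x).tree.level ((shift^[m] x).neck 0)) →
      ∀ n, (concatWord y n).length = x.neckLevel n := fun y hy n =>
    (CodeTree.mem_level.1 (concatWord_mem_level n hy)).2
  have hinit : ∀ y : ℕ → List ℕ, (∀ m, y m ∈ (shift^[m] x).tree.level ((shift^[m] x).neck 0)) →
      ∀ n, CodeTree.initWord (concatPath y) (x.neckLevel n) = concatWord y n := by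
    intro y hy n
    rw [← hlen y hy n]
    refine initWord_concatPath (fun n => ?_) n
    rw [hlen y hy]
    exact x.neckLevel_strictMono.le_apply
  refine ⟨ρ.map concatPath, Measure.isProbabilityMeasure_map measurable_concatPath.aemeasurable,
    ?_, fun n τ => ?_⟩
  · have hms : MeasurableSet {i : ℕ → ℕ | i ∈ x.tree.paths} := by
      have : {i : ℕ → ℕ | i ∈ x.tree.paths} =
          ⋂ k, (fun i => CodeTree.initWord i k) ⁻¹' x.tree.words := by
        ext i
        simp [CodeTree.paths]
      rw [this]
      exact MeasurableSet.iInter fun k => measurable_initWord k trivial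
    rw [ae_map_iff measurable_concatPath.aemeasurable hms]
    filter_upwards [hgood] with y hy k
    -- Since `k ≤ neckLevel k`, the initial word of length `k` is a prefix of the concatenation of
    -- `k` blocks, which lies in the tree.
    obtain ⟨l, hl⟩ := Nat.exists_eq_add_of_le (x.neckLevel_strictMono.le_apply (x := k))
    have h := (CodeTree.mem_level.1 (concatWord_mem_level k hy)).1
    rw [← hinit y hy k, hl, CodeTree.initWord_add] at h
    exact CodeTree.mem_words_of_append h
  · have hms : MeasurableSet {i | CodeTree.initWord i (x.neckLevel n) = τ} :=
      measurable_initWord (x.neckLevel n) (MeasurableSet.singleton τ)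
    rw [Measure.map_apply measurable_concatPath hms]
    -- Block lengths are prescribed by the necks, so an admissible `τ` determines its blocks and its
    -- cylinder lies, up to a null set, in a product cylinder. For any other `τ` the event is null.
    by_cases hex : ∃ z : ℕ → List ℕ,
        (∀ m, z m ∈ (shift^[m] x).tree.level ((shift^[m] x).neck 0)) ∧ concatWord z n = τ
    · obtain ⟨z, hz, rfl⟩ := hex
      calc ρ (concatPath ⁻¹' {i | CodeTree.initWord i (x.neckLevel n) = concatWord z n})
          ≤ ρ (Set.pi (Finset.range n) fun m => {z m}) := by
            refine measure_mono_ae ?_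
            filter_upwards [hgood] with y hy h
            have h' : concatWord y n = concatWord z n := (hinit y hy n).symm.trans h
            have hl : ∀ m, (y m).length = (z m).length := fun m =>
              (CodeTree.mem_level.1 (hy m)).2.trans (CodeTree.mem_level.1 (hz m)).2.symm
            exact fun m hm => eq_of_concatWord_eq hl h' m (by simpa using hm)
        _ = ∏ m ∈ Finset.range n, (shift^[m] x).blockMeasure t {z m} :=
            Measure.infinitePi_pi _ fun m _ => MeasurableSet.singleton _
        _ = ENNReal.ofReal (F.ratioWord x.tree.label (concatWord z n) ^ t /
              x.tree.S (x.neckLevel n) t) := by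
            rw [ratioWord_concatWord n hz, S_neckLevel hF ht,
              ← Real.finsetProd_rpow _ _ fun m _ => F.ratioWord_nonneg _ _,
              ← Finset.prod_div_distrib, ENNReal.ofReal_prod_of_nonneg]
            · exact Finset.prod_congr rfl fun m _ => blockMeasure_singleton (hz m)
            · exact fun m _ => div_nonneg (Real.rpow_nonneg (F.ratioWord_nonneg _ _) _)
                (CodeTree.S_pos hF _ ht).le
    · refine le_of_eq_of_le ?_ zero_le
      rw [← nonpos_iff_eq_zero, ← measure_empty (μ := ρ)]
      refine measure_mono_ae ?_
      filter_upwards [hgood] with y hy h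
      exact hex ⟨y, hy, (hinit y hy n).symm.trans h⟩

end NeckTree

end CodeTreeFractal

end

/-! ### Finite energy and the lower bound of the dimension -/

noncomputable section

namespace CodeTreeFractal

open scoped ENNReal NNReal

namespace AffineFamily

variable {D : ℕ} {Λ : Type*} {F : AffineFamily D Λ}

theorem continuous_trans (o : Option Λ) (l : ℕ) : Continuous fun a : F.Param => F.trans a o l := by
  simp only [trans_eq]
  rcases F.cls o l with _ | u
  · exact continuous_const
  · exact continuous_apply u

theorem continuous_mapWord (w : List ℕ) : ∀ g : List ℕ → Option Λ,
    Continuous fun a : F.Param => F.mapWord a g w 0 := by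
  induction w with
  | nil => intro g; exact continuous_const
  | cons l w ih =>
    intro g
    exact ((F.lin (g []) l).continuous_of_finiteDimensional.comp (ih _)).add
      (continuous_trans _ _)

variable [Fintype (Quotient F.rel)] {σlo σhi : ℝ} (hF : F.IsUniformlySimilar σlo σhi)

include hF

theorem measurable_point (g : List ℕ → Option Λ) :
    Measurable fun p : F.Param × (ℕ → ℕ) => F.point p.1 g p.2 := by
  refine measurable_of_tendsto_metrizable
    (f := fun k (p : F.Param × (ℕ → ℕ)) => F.mapWord p.1 g (CodeTree.initWord p.2 k) 0)
    (fun k => ?_) (tendsto_pi_nhds.2 fun p => tendsto_mapWord_point hF p.1 g p.2)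
  have h : Measurable fun p : F.Param × List ℕ => F.mapWord p.1 g p.2 0 :=
    measurable_from_prod_countable_left fun w => (continuous_mapWord w g).measurable
  exact h.comp (measurable_fst.prodMk ((measurable_initWord k).comp measurable_snd))

end AffineFamily

namespace CodeTree

open AffineFamily

variable {D : ℕ} {Λ : Type*} {F : AffineFamily D Λ} {σlo σhi : ℝ}
  (hF : F.IsUniformlySimilar σlo σhi)

include hF

theorem ratioWord_mul_pow_le {ω : CodeTree F} {v w : List ℕ} (h : v ++ w ∈ ω.words) :
    F.ratioWord ω.label v * σlo ^ w.length ≤ F.ratioWord ω.label (v ++ w) := by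
  induction w using List.reverseRecOn with
  | nil => simp
  | append_singleton w l ih =>
    rw [← List.append_assoc] at h ⊢
    rw [ratioWord_concat, List.length_append, List.length_singleton, pow_succ, ← mul_assoc]
    exact mul_le_mul (ih (mem_words_of_concat h)) (hF.le_ratio (concat_mem_words.1 h))
      hF.lo_pos.le (F.ratioWord_nonneg _ _)

variable [Fintype (Quotient F.rel)]

/-- With `τ` the common prefix, the difference of the limit points is the linear part along `τ`
applied to the difference of the tail points. The first factor scales norms by the ratio of `τ`. The
second expands in some coordinate, as the tails start in different classes. -/
theorem exists_lintegral_point_sub_le {t : ℝ} (ht0 : 0 ≤ t) (ht : t < D) {R : ℝ} (hR : 0 < R) :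
    ∃ C : ℝ≥0∞, C ≠ 0 ∧ C ≠ ⊤ ∧ ∀ (ω : CodeTree F) (i j : ℕ → ℕ) (k : ℕ), i ∈ ω.paths →
      j ∈ ω.paths → initWord i k = initWord j k → i k ≠ j k →
        ∫⁻ a in (Set.univ.pi fun _ => Metric.ball 0 R : Set F.Param),
          ‖F.point a ω.label i - F.point a ω.label j‖ₑ ^ (-t) ≤
            C * ENNReal.ofReal (F.ratioWord ω.label (initWord i k)) ^ (-t) := by
  classical
  obtain ⟨C, hC, hCb⟩ := exists_lintegral_enorm_linearMap_rpow_le hF.dim_pos ht0 ht hR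
    (Quotient F.rel)
  have hq : 0 < 1 - σhi / (1 - σhi) := by
    rw [sub_pos, div_lt_one (by linarith [hF.hi_lt])]
    linarith [hF.hi_lt]
  have hc0 : ENNReal.ofReal (1 - σhi / (1 - σhi)) ≠ 0 := by simpa using hq
  have hct : ENNReal.ofReal (1 - σhi / (1 - σhi)) ^ t ≠ 0 := by simp [hc0]
  -- The summand `1` makes the constant nonzero, which `le_tsum_kernel` needs on the diagonal.
  refine ⟨(C + 1) * ENNReal.ofReal (1 - σhi / (1 - σhi)) ^ (-t), ?_, ?_,
    fun ω i j k hi hj hij hk => ?_⟩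
  · refine mul_ne_zero (by simp) ?_
    rw [ENNReal.rpow_neg]
    exact ENNReal.inv_ne_zero.2 (ENNReal.rpow_ne_top_of_nonneg ht0 ENNReal.ofReal_ne_top)
  · refine ENNReal.mul_ne_top (ENNReal.add_ne_top.2 ⟨hC, ENNReal.one_ne_top⟩) ?_
    rw [ENNReal.rpow_neg]
    exact ENNReal.inv_ne_top.2 hct
  set τ := initWord i k with hτ
  set g' : List ℕ → Option Λ := fun v => ω.label (τ ++ v) with hg'
  set i' : ℕ → ℕ := fun n => i (k + n) with hi'
  set j' : ℕ → ℕ := fun n => j (k + n) with hj'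
  have hτi : i k < F.deg (ω.label τ) := by
    rw [← concat_mem_words, hτ, ← initWord_succ]
    exact hi (k + 1)
  have hτj : j k < F.deg (ω.label τ) := by
    rw [← concat_mem_words, hij, ← initWord_succ]
    exact hj (k + 1)
  obtain ⟨u, hu⟩ := cls_ne_none hτi
  obtain ⟨v, hv⟩ := cls_ne_none hτj
  have huv : u ≠ v := by
    rintro rfl
    exact hk (cls_injective hu hv)
  have hτpos : 0 < F.ratioWord ω.label τ := ratioWord_pos hF (hi k)
  have hg0 : g' [] = ω.label τ := by simp [hg']
  obtain ⟨w, hw⟩ := exists_expanding_coordinate hF (g := g') (i := i') (j := j') (u := u) (v := v)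
    (by rw [hg0]; exact hu) (by rw [hg0]; exact hv) huv
  have h := hCb (F.linWord ω.label τ ∘ₗ (pointLinear hF g' i' - pointLinear hF g' j'))
    (F.ratioWord ω.label τ * (1 - σhi / (1 - σhi))) (mul_pos hτpos hq) ⟨w, fun h => by
      rw [LinearMap.comp_apply, hF.norm_linWord, mul_assoc]
      exact mul_le_mul_of_nonneg_left (hw h) hτpos.le⟩
  have hdiff : ∀ a : F.Param, F.point a ω.label i - F.point a ω.label j =
      (F.linWord ω.label τ ∘ₗ (pointLinear hF g' i' - pointLinear hF g' j')) a := by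
    intro a
    rw [point_eq hF a ω.label i k, point_eq hF a ω.label j k, ← hij, ← hτ, add_sub_add_right_eq_sub,
      ← map_sub]
    rfl
  simp only [hdiff]
  refine h.trans ?_
  rw [mul_comm (F.ratioWord _ _), ENNReal.ofReal_mul hq.le,
    ENNReal.mul_rpow_of_ne_top ENNReal.ofReal_ne_top ENNReal.ofReal_ne_top, ← mul_assoc]
  gcongr
  exact le_self_add

end CodeTree

namespace NeckTree

open AffineFamily

variable {D : ℕ} {Λ : Type*} {F : AffineFamily D Λ} {σlo σhi : ℝ}
  (hF : F.IsUniformlySimilar σlo σhi)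

include hF

/-- The logarithm of the term is `-t log σlo` times a gap of order `o(n)`, minus `log S(N_n) ~ q c
n`. The terms are eventually below the geometric sequence of ratio `exp (-q c / 2)`. -/
theorem summable_gap_div_S (x : NeckTree F) {c : ℝ} (hc : 0 < c)
    (hNc : Tendsto (fun n : ℕ => (x.neckLevel n : ℝ) / n) atTop (𝓝 c)) {t q : ℝ} (ht : 0 ≤ t)
    (hp : x.tree.HasPressure t q) (hq : 0 < q) :
    Summable fun n => (σlo ^ (x.neckLevel (n + 1) - x.neckLevel n)) ^ (-t) /
      x.tree.S (x.neckLevel n) t := by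
  have hlog : Tendsto (fun n : ℕ => Real.log (x.tree.S (x.neckLevel n) t) / n) atTop
      (𝓝 (q * c)) := by
    refine ((hp.comp x.neckLevel_strictMono.tendsto_atTop).mul hNc).congr' ?_
    filter_upwards [eventually_gt_atTop 0] with n hn
    have : ((x.neckLevel n : ℕ) : ℝ) ≠ 0 := by
      exact_mod_cast (hn.trans_le x.neckLevel_strictMono.le_apply).ne'
    rw [Function.comp_apply, div_mul_div_cancel₀ this]
  have hgap := (tendsto_succ_sub_div hNc).const_mul (-t * Real.log σlo)
  rw [mul_zero] at hgap
  have hdiff := hgap.sub hlog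
  have hqc : 0 < q * c := mul_pos hq hc
  have hev := hdiff.eventually (gt_mem_nhds (show 0 - q * c < -(q * c / 2) by linarith))
  refine Summable.of_norm_bounded_eventually_nat (g := fun n : ℕ => Real.exp (-(q * c / 2)) ^ n)
    (summable_geometric_of_lt_one (Real.exp_pos _).le (by rw [Real.exp_lt_one_iff]; linarith)) ?_
  filter_upwards [hev, eventually_gt_atTop 0] with n hn hn0
  have hn0' : (0 : ℝ) < n := by exact_mod_cast hn0
  have hS := CodeTree.S_pos (ω := x.tree) hF (x.neckLevel n) ht
  have hpow : 0 < σlo ^ (x.neckLevel (n + 1) - x.neckLevel n) := pow_pos hF.lo_pos _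
  have hpos := div_pos (Real.rpow_pos_of_pos hpow (-t)) hS
  rw [Real.norm_of_nonneg hpos.le, ← Real.exp_nat_mul, ← Real.log_le_iff_le_exp hpos,
    Real.log_div (Real.rpow_pos_of_pos hpow _).ne' hS.ne', Real.log_rpow hpow, Real.log_pow,
    Nat.cast_sub (x.neckLevel_strictMono n.lt_succ_self).le]
  rw [← mul_div_assoc, ← sub_div, div_lt_iff₀ hn0'] at hn
  linarith

/-- If the codes branch at `k` with `N_n ≤ k < N_{n+1}`, passing from the neck to level `k` shrinks
the ratio by at most `σlo ^ (N_{n+1} - N_n)`. The `n`-th term alone then dominates; the full sum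
avoids naming `n`. -/
theorem le_tsum_kernel {x : NeckTree F} {t : ℝ} (ht0 : 0 ≤ t) {f : (ℕ → ℕ) → (ℕ → ℕ) → ℝ≥0∞}
    {C : ℝ≥0∞} (hC : C ≠ 0) {i j : ℕ → ℕ} (hi : i ∈ x.tree.paths)
    (hf : ∀ k, CodeTree.initWord i k = CodeTree.initWord j k → i k ≠ j k →
      f i j ≤ C * ENNReal.ofReal (F.ratioWord x.tree.label (CodeTree.initWord i k)) ^ (-t)) :
    f i j ≤ C * ∑' n, {j | CodeTree.initWord j (x.neckLevel n) =
        CodeTree.initWord i (x.neckLevel n)}.indicator (fun _ =>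
          ENNReal.ofReal (F.ratioWord x.tree.label (CodeTree.initWord i (x.neckLevel n)) *
            σlo ^ (x.neckLevel (n + 1) - x.neckLevel n)) ^ (-t)) j := by
  have hr : ∀ n, F.ratioWord x.tree.label (CodeTree.initWord i n) ≤ 1 := fun n =>
    (hF.ratioWord_le _ _).trans (pow_le_one₀ hF.hi_pos.le hF.hi_lt_one.le)
  -- On the diagonal every term of the series is at least `1`, so the right side is `⊤`; no separate
  -- proof that the diagonal is null is needed.
  by_cases hij : i = j
  · subst hij
    refine le_of_le_of_eq le_top ?_
    symm
    rw [ENNReal.mul_eq_top]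
    left
    refine ⟨hC, top_le_iff.1 ?_⟩
    rw [← ENNReal.tsum_const_eq_top_of_ne_zero (α := ℕ) (c := 1) one_ne_zero]
    refine ENNReal.tsum_le_tsum fun n => ?_
    rw [Set.indicator_of_mem (by simp), ENNReal.rpow_neg, ENNReal.one_le_inv]
    refine ENNReal.rpow_le_one ?_ ht0
    rw [ENNReal.ofReal_le_one]
    exact mul_le_one₀ (hr _) (pow_nonneg hF.lo_pos.le _)
      (pow_le_one₀ hF.lo_pos.le hF.lo_lt_one.le)
  · have hex : ∃ k, i k ≠ j k := Function.ne_iff.1 hij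
    classical
    set k := Nat.find hex with hk
    have hkne : i k ≠ j k := Nat.find_spec hex
    have hkeq : ∀ n ≤ k, CodeTree.initWord i n = CodeTree.initWord j n := fun n hn =>
      CodeTree.initWord_eq_iff.2 fun m hm => not_not.1 (Nat.find_min hex (hm.trans_le hn))
    have hexn : ∃ n, k < x.neckLevel (n + 1) :=
      ⟨k, x.neckLevel_strictMono.le_apply.trans_lt (x.neckLevel_strictMono k.lt_succ_self)⟩
    obtain ⟨n, hn1, hn2⟩ : ∃ n, x.neckLevel n ≤ k ∧ k < x.neckLevel (n + 1) := by
      refine ⟨Nat.find hexn, ?_, Nat.find_spec hexn⟩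
      rcases h : Nat.find hexn with _ | m
      · exact Nat.zero_le _
      · exact not_lt.1 (Nat.find_min hexn (m := m) (by omega))
    refine (hf k (hkeq k le_rfl) hkne).trans ?_
    gcongr
    refine le_trans ?_ (ENNReal.le_tsum n)
    rw [Set.indicator_of_mem (by exact (hkeq _ hn1).symm), ENNReal.rpow_neg, ENNReal.rpow_neg]
    refine ENNReal.inv_le_inv.2 (ENNReal.rpow_le_rpow (ENNReal.ofReal_le_ofReal ?_) ht0)
    obtain ⟨l, hl⟩ := Nat.exists_eq_add_of_le hn1
    have hw := hi k
    rw [hl, CodeTree.initWord_add] at hw ⊢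
    refine le_trans ?_ (CodeTree.ratioWord_mul_pow_le hF hw)
    rw [CodeTree.length_initWord]
    refine mul_le_mul_of_nonneg_left ?_ (F.ratioWord_nonneg _ _)
    exact pow_le_pow_of_le_one hF.lo_pos.le hF.lo_lt_one.le (by omega)

/-- In each term the mass `r ^ t / S` of the cylinder cancels the factor `r ^ (-t)` of the kernel,
which leaves a bound independent of `i`. -/
theorem lintegral_kernel_le {x : NeckTree F} {t : ℝ} {μ : Measure (ℕ → ℕ)}
    (hμ : ∀ n, ∀ τ : List ℕ, μ {i | CodeTree.initWord i (x.neckLevel n) = τ} ≤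
        ENNReal.ofReal (F.ratioWord x.tree.label τ ^ t / x.tree.S (x.neckLevel n) t))
    {i : ℕ → ℕ} (hi : i ∈ x.tree.paths) :
    ∫⁻ j, ∑' n, {j | CodeTree.initWord j (x.neckLevel n) =
        CodeTree.initWord i (x.neckLevel n)}.indicator (fun _ =>
          ENNReal.ofReal (F.ratioWord x.tree.label (CodeTree.initWord i (x.neckLevel n)) *
            σlo ^ (x.neckLevel (n + 1) - x.neckLevel n)) ^ (-t)) j ∂μ ≤
      ∑' n, ENNReal.ofReal ((σlo ^ (x.neckLevel (n + 1) - x.neckLevel n)) ^ (-t) /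
        x.tree.S (x.neckLevel n) t) := by
  have hms : ∀ n (τ : List ℕ), MeasurableSet {j | CodeTree.initWord j (x.neckLevel n) = τ} :=
    fun n τ => measurable_initWord (x.neckLevel n) (MeasurableSet.singleton τ)
  rw [lintegral_tsum fun n => (measurable_const.indicator (hms n _)).aemeasurable]
  refine ENNReal.tsum_le_tsum fun n => ?_
  rw [lintegral_indicator_const (hms n _)]
  set r := F.ratioWord x.tree.label (CodeTree.initWord i (x.neckLevel n)) with hr
  have hr0 : 0 < r := CodeTree.ratioWord_pos hF (hi _)
  have hpow : 0 < σlo ^ (x.neckLevel (n + 1) - x.neckLevel n) := pow_pos hF.lo_pos _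
  refine (mul_le_mul_right (hμ n _) _).trans (le_of_eq ?_)
  rw [ENNReal.ofReal_rpow_of_pos (mul_pos hr0 hpow), ← ENNReal.ofReal_mul
    (Real.rpow_nonneg (mul_pos hr0 hpow).le _), ← hr, Real.mul_rpow hr0.le hpow.le,
    Real.rpow_neg hr0.le]
  congr 1
  have := (Real.rpow_pos_of_pos hr0 t).ne'
  field_simp

variable [Fintype (Quotient F.rel)]

/-- The lower bound of the dimension for almost all translations in a box. -/
theorem ae_le_dimH_attractor (x : NeckTree F) {c : ℝ} (hc : 0 < c)
    (hNc : Tendsto (fun n : ℕ => (x.neckLevel n : ℝ) / n) atTop (𝓝 c)) {t : ℝ≥0} (ht0 : 0 < t)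
    (ht : (t : ℝ) < D) {q : ℝ} (hp : x.tree.HasPressure t q) (hq : 0 < q) {R : ℝ} (hR : 0 < R) :
    ∀ᵐ a ∂(volume : Measure F.Param).restrict (Set.univ.pi fun _ => Metric.ball 0 R),
      (t : ℝ≥0∞) ≤ dimH (x.tree.attractor a) := by
  have ht0' : (0 : ℝ) ≤ t := t.2
  obtain ⟨μ, hμp, hμ1, hμ2⟩ := exists_path_measure hF x ht0'
  obtain ⟨C, hC0, hCt, hC⟩ := CodeTree.exists_lintegral_point_sub_le hF ht0' ht hR
  set g := x.tree.label with hg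
  set ν : Measure F.Param := volume.restrict (Set.univ.pi fun _ => Metric.ball 0 R) with hν
  set B : ℝ≥0∞ := ∑' n, ENNReal.ofReal
    ((σlo ^ (x.neckLevel (n + 1) - x.neckLevel n)) ^ (-(t : ℝ)) / x.tree.S (x.neckLevel n) t)
    with hB
  have hBt : B ≠ ⊤ := (summable_gap_div_S hF x hc hNc ht0' hp hq).tsum_ofReal_ne_top
  set f : F.Param → (ℕ → ℕ) × (ℕ → ℕ) → ℝ≥0∞ := fun a p =>
    ‖F.point a g p.1 - F.point a g p.2‖ₑ ^ (-(t : ℝ)) with hf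
  have hpm := measurable_point hF g
  have hfm : Measurable (Function.uncurry f) := by
    refine Measurable.pow_const (Measurable.enorm (Measurable.sub ?_ ?_)) _
    · exact hpm.comp (measurable_fst.prodMk (measurable_fst.comp measurable_snd))
    · exact hpm.comp (measurable_fst.prodMk (measurable_snd.comp measurable_snd))
  -- By Tonelli the translations are integrated first, where transversality applies, and the pair of
  -- paths afterwards.
  have henergy : ∫⁻ a, ∫⁻ p, f a p ∂(μ.prod μ) ∂ν ≤ C * B := by
    rw [lintegral_lintegral_swap hfm.aemeasurable]
    have hm2 : Measurable fun p => ∫⁻ a, f a p ∂ν := hfm.lintegral_prod_left'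
    rw [lintegral_prod _ hm2.aemeasurable]
    calc ∫⁻ i, ∫⁻ j, ∫⁻ a, f a (i, j) ∂ν ∂μ ∂μ
        ≤ ∫⁻ _, C * B ∂μ := by
          refine lintegral_mono_ae ?_
          filter_upwards [hμ1] with i hi
          refine le_trans ?_ (mul_le_mul_right (lintegral_kernel_le hF hμ2 hi) C)
          rw [← lintegral_const_mul' _ _ hCt]
          refine lintegral_mono_ae ?_
          filter_upwards [hμ1] with j hj
          exact le_tsum_kernel hF ht0' (f := fun i j => ∫⁻ a, f a (i, j) ∂ν) hC0 hi
            fun k hk hk' => hC x.tree i j k hi hj hk hk'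
      _ = C * B := by simp
  have hfin : ∀ᵐ a ∂ν, ∫⁻ p, f a p ∂(μ.prod μ) < ⊤ :=
    ae_lt_top hfm.lintegral_prod_right'
      (ne_top_of_le_ne_top (ENNReal.mul_ne_top hCt hBt) henergy)
  filter_upwards [hfin] with a ha
  have hpa : Measurable fun i => F.point a g i := hpm.comp measurable_prodMk_left
  refine le_dimH_of_energy_ne_top (ν := μ.map fun i => F.point a g i) ht0 ?_ ?_
  -- No measurability of the attractor is needed: `le_map_apply` bounds the push-forward from below
  -- on every set.
  · have h1 : μ ((fun i => F.point a g i) ⁻¹' x.tree.attractor a) = 1 := by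
      rw [← measure_univ (μ := μ)]
      refine measure_congr ?_
      filter_upwards [hμ1] with i hi
      exact propext (iff_of_true ((CodeTree.mem_attractor_iff hF).2 ⟨i, hi, rfl⟩) trivial)
    have h2 := Measure.le_map_apply (μ := μ) hpa.aemeasurable (x.tree.attractor a)
    rw [h1] at h2
    exact (zero_lt_one.trans_le h2).ne'
  · have hk : Measurable fun p : EuclideanSpace ℝ (Fin D) × EuclideanSpace ℝ (Fin D) =>
        edist p.1 p.2 ^ (-(t : ℝ)) := measurable_edist.pow_const _
    rw [lintegral_map hk.lintegral_prod_right' hpa]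
    refine ne_of_eq_of_ne ?_ ha.ne
    have hfa : Measurable (f a) :=
      ((hpa.comp measurable_fst).sub (hpa.comp measurable_snd)).enorm.pow_const _
    rw [lintegral_prod _ hfa.aemeasurable]
    refine lintegral_congr fun i => ?_
    rw [lintegral_map (f := fun y => edist (F.point a g i) y ^ (-(t : ℝ)))
      (measurable_const.edist measurable_id |>.pow_const _) hpa]
    refine lintegral_congr fun j => ?_
    rw [hf, edist_eq_enorm_sub]

end NeckTree

end CodeTreeFractal

end

/-! ### Assembling the dimension formula -/

namespace CodeTreeFractal

namespace AffineFamily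

open scoped ENNReal NNReal

variable {D : ℕ} {Λ : Type*} {F : AffineFamily D Λ}

theorem isUniformlySimilar [Nonempty Λ] (hD : 1 ≤ D)
    (hsim : ∀ (lam : Λ) (i : Fin (F.m lam)), IsSimilarity (F.T lam i))
    {σlo σhi : ℝ} (hlo : 0 < σlo) (hhi : σhi < 1 / 2)
    (hσ : ∀ (lam : Λ) (i : Fin (F.m lam)),
      σlo ≤ (F.T lam i).singularValues (D - 1) ∧ (F.T lam i).singularValues 0 ≤ σhi) :
    F.IsUniformlySimilar σlo σhi := by
  have hmem : ∀ lam i, (F.T lam i).singularValues 0 ∈ Set.Icc σlo σhi := fun lam i =>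
    ⟨(hσ lam i).1.trans ((F.T lam i).singularValues_antitone (Nat.zero_le _)), (hσ lam i).2⟩
  obtain ⟨lam⟩ := ‹Nonempty Λ›
  have h := hmem lam ⟨0, F.m_pos lam⟩
  exact ⟨hD, hlo, h.1.trans h.2, hhi, fun lam i v => norm_map_of_isSimilarity hD (hsim lam i) v,
    hmem⟩

end AffineFamily

namespace NeckTree

open scoped ENNReal NNReal

variable {D : ℕ} {Λ : Type*} {F : AffineFamily D Λ} {σlo σhi : ℝ}
  (hF : F.IsUniformlySimilar σlo σhi)

include hF

/-- The pressure is negative above `α₀` and positive below it. The upper bound, with exponents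
decreasing to `α₀`, holds for every translation. The lower bound uses rational `t` below `min α₀ D`
and boxes exhausting the parameter space, so only countably many null sets occur. -/
theorem ae_dimH_attractor_eq [Fintype (Quotient F.rel)] (x : NeckTree F) {c : ℝ} (hc : 0 < c)
    (hNc : Tendsto (fun n : ℕ => (x.neckLevel n : ℝ) / n) atTop (𝓝 c)) {p : ℝ → ℝ}
    (hp : ∀ α, 0 ≤ α → x.tree.HasPressure α (p α)) {α₀ : ℝ} (hα₀ : 0 ≤ α₀) (hz : p α₀ = 0) :
    ∀ᵐ a : F.Param, dimH (x.tree.attractor a) = ENNReal.ofReal (min α₀ (D : ℝ)) := by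
  have hhi : Real.log σhi < 0 := Real.log_neg hF.hi_pos hF.hi_lt_one
  have hneg : ∀ α, α₀ < α → p α < 0 := by
    intro α hα
    have := ((hp α₀ hα₀).sub_mem hF hα₀ hα.le (hp α (hα₀.trans hα.le))).2
    nlinarith [mul_neg_of_pos_of_neg (sub_pos.2 hα) hhi]
  have hpos : ∀ α, 0 ≤ α → α < α₀ → 0 < p α := by
    intro α h0 hα
    have := ((hp α h0).sub_mem hF h0 hα.le (hp α₀ hα₀)).2
    nlinarith [mul_neg_of_pos_of_neg (sub_pos.2 hα) hhi]
  have hupper : ∀ a : F.Param, dimH (x.tree.attractor a) ≤ ENNReal.ofReal (min α₀ (D : ℝ)) := by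
    intro a
    rw [ENNReal.ofReal_min]
    refine le_min ?_ ?_
    · refine ENNReal.le_of_forall_pos_le_add fun ε hε _ => ?_
      rw [← ENNReal.ofReal_coe_nnreal (p := ε), ← ENNReal.ofReal_add hα₀ ε.coe_nonneg]
      have hlt : α₀ < α₀ + ε := lt_add_of_pos_right _ (by exact_mod_cast hε)
      exact CodeTree.dimH_attractor_le hF a (hα₀.trans hlt.le) (hp _ (hα₀.trans hlt.le))
        (hneg _ hlt)
    · refine (dimH_mono (Set.subset_univ _)).trans ?_
      rw [Real.dimH_univ_eq_finrank]
      simp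
  have hbox : ∀ t : ℚ, (0 : ℝ) < t → (t : ℝ) < min α₀ D →
      ∀ᵐ a : F.Param, ENNReal.ofReal t ≤ dimH (x.tree.attractor a) := by
    intro t ht0 ht
    have hcover : (⋃ n : ℕ, Set.univ.pi fun _ => Metric.ball 0 ((n : ℝ) + 1) : Set F.Param) =
        Set.univ := by
      refine Set.eq_univ_of_forall fun a => ?_
      obtain ⟨n, hn⟩ := exists_nat_gt ‖a‖
      refine Set.mem_iUnion.2 ⟨n, fun u _ => ?_⟩
      rw [mem_ball_zero_iff]
      linarith [norm_le_pi_norm a u]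
    rw [← Measure.restrict_univ (μ := (volume : Measure F.Param)), ← hcover,
      ae_restrict_iUnion_iff]
    intro n
    have hp' := hp t ht0.le
    have hq := hpos t ht0.le (ht.trans_le (min_le_left _ _))
    have htD := ht.trans_le (min_le_right _ _)
    generalize (t : ℝ) = s at *
    lift s to ℝ≥0 using ht0.le
    rw [ENNReal.ofReal_coe_nnreal]
    exact ae_le_dimH_attractor hF x hc hNc (by exact_mod_cast ht0) htD hp' hq (by positivity)
  have hall : ∀ᵐ a : F.Param, ∀ t : ℚ, (0 : ℝ) < t → (t : ℝ) < min α₀ D →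
      ENNReal.ofReal t ≤ dimH (x.tree.attractor a) :=
    ae_all_iff.2 fun t => by
      by_cases h0 : (0 : ℝ) < t ∧ (t : ℝ) < min α₀ D
      · filter_upwards [hbox t h0.1 h0.2] with a ha _ _ using ha
      · exact Eventually.of_forall fun a h1 h2 => absurd ⟨h1, h2⟩ h0
  filter_upwards [hall] with a ha
  refine le_antisymm (hupper a) (le_of_forall_lt fun b hb => ?_)
  have hbt : b ≠ ⊤ := ne_top_of_lt hb
  rw [← ENNReal.ofReal_toReal hbt] at hb ⊢
  obtain ⟨t, ht1, ht2⟩ := exists_rat_btwn ((ENNReal.ofReal_lt_ofReal_iff_of_nonneg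
    ENNReal.toReal_nonneg).1 hb)
  have ht0 : (0 : ℝ) < t := ENNReal.toReal_nonneg.trans_lt ht1
  exact ((ENNReal.ofReal_lt_ofReal_iff ht0).2 ht1).trans_le (ha t ht0 ht2)

end NeckTree

end CodeTreeFractal

theorem proposition5p7 {D : ℕ} (hD : 1 ≤ D) {Λ : Type*}
    (F : CodeTreeFractal.AffineFamily D Λ) [Fintype (Quotient F.rel)]
    (hsim : ∀ (lam : Λ) (i : Fin (F.m lam)), CodeTreeFractal.IsSimilarity (F.T lam i))
    (σlo σhi : ℝ) (hlo : 0 < σlo) (hhi : σhi < 1 / 2)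
    (hσ : ∀ (lam : Λ) (i : Fin (F.m lam)),
      σlo ≤ (F.T lam i).singularValues (D - 1) ∧ (F.T lam i).singularValues 0 ≤ σhi)
    (P : Measure (CodeTreeFractal.NeckTree F)) [IsProbabilityMeasure P]
    (hP : Ergodic (CodeTreeFractal.NeckTree.shift (F := F)) P)
    (hN : Integrable (fun x : CodeTreeFractal.NeckTree F => (x.neck 0 : ℝ)) P) :
    ∃ (p : ℝ → ℝ) (α₀ : ℝ),
      (∀ᵐ x ∂P, ∀ α : ℝ, 0 ≤ α → x.tree.HasPressure α (p α)) ∧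
      (0 ≤ α₀ ∧ ∀ α : ℝ, 0 ≤ α → (p α = 0 ↔ α = α₀)) ∧
      ∀ᵐ x ∂P, ∀ᵐ a : F.Param,
        dimH (x.tree.attractor a) = ENNReal.ofReal (min α₀ (D : ℝ)) := by
  obtain ⟨z⟩ := nonempty_of_isProbabilityMeasure P
  -- A probability measure forces some tree to exist, and its root carries a label. A single map
  -- then yields `σlo ≤ σhi`.
  have : Nonempty Λ := ⟨(z.tree.label []).get z.tree.root⟩
  have hF := CodeTreeFractal.AffineFamily.isUniformlySimilar hD hsim hlo hhi hσ
  obtain ⟨p, hp⟩ := CodeTreeFractal.NeckTree.exists_pressure hF hP hN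
  -- The function `p` is common to almost all trees, so its zero can be found from one of them.
  obtain ⟨y, hy⟩ := hp.exists
  obtain ⟨α₀, hα₀, hz⟩ := CodeTreeFractal.CodeTree.exists_unique_zero_of_hasPressure hF hy
  refine ⟨p, α₀, hp, ⟨hα₀, hz⟩, ?_⟩
  filter_upwards [hp, CodeTreeFractal.NeckTree.ae_tendsto_neckLevel_div hP hN] with x hx hNx
  exact CodeTreeFractal.NeckTree.ae_dimH_attractor_eq hF x
    (CodeTreeFractal.NeckTree.integral_neck_pos hN) hNx hx hα₀ ((hz α₀ hα₀).2 rfl)
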